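/- Let $2^{\mathbb N}$ be the set of infinite binary sequences. A $\Pi^0_1$ class is the complement in $2^{\mathbb N}$ of a union $\bigcup_{\sigma\in S}[\![\sigma]\!]$ of cylinders, where $S$ is a c.e. set of finite binary strings; its canonical tree is $T=\{\sigma : [\![\sigma]\!]\cap\mathcal C\neq\emptyset\}$, and $T_n$ is the set of strings in $T$ of length $n$. A continuous semi-measure is a map $\rho:2^{<\mathbb N}\to[0,1]$ with $\rho(\Lambda)=1$ for the empty string $\Lambda$ and $\rho(\sigma)\ge\rho(\sigma0)+\rho(\sigma1)$ for all $\sigma$. It is lower semi-computable if $\rho(\sigma)=\lim_i\tilde\rho(\sigma,i)$ for a computable dyadic-valued $\tilde\rho$ that is non-decreasing in $i$. A lower semi-computable continuous semi-measure $\mathbf M$ is universal if for every lower semi-computable continuous semi-measure $\rho$ there is $c\in\mathbb N$ with $\rho(\sigma)\le c\cdot\mathbf M(\sigma)$ for all $\sigma$. A universal lower semi-computable continuous semi-measure exists; let $\mathbf M$ be any such. A $\Pi^0_1$ class $\mathcal C$ with canonical tree $T$ is deep if there is a computable, non-decreasing, unbounded $h:\mathbb N\to\mathbb N$ with $\sum_{\sigma\in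 T_n}\mathbf M(\sigma)\le 2^{-h(n)}$ for all $n$. It is negligible if $\overline{\mathbf M}(\mathcal C)=0$, where $\overline{\mathbf M}$ is the measure on $2^{\mathbb N}$ with $\overline{\mathbf M}([\![\sigma]\!])=\inf_{n\ge|\sigma|}\sum_{\tau\succeq\sigma,\,|\tau|=n}\mathbf M(\tau)$. Two classes have the same Turing degrees if every member of either one is Turing equivalent to a member of the other. They are Muchnik equivalent if every member of either one computes a member of the other. Theorem. (1) For every non-empty $\Pi^0_1$ class $\mathcal C$ there is a $\Pi^0_1$ class $\mathcal D$ such that $\mathcal D$ is not deep, and the members of $\mathcal D$ are those of $\mathcal C$ up to deletion of a finite prefix: $\mathcal C\subseteq\mathcal D$, and every $Y\in\mathcal D$ has the form $\sigma^\frown X$ with $\sigma$ a finite string and $X\in\mathcal C$. In particular $\mathcal C$ and $\mathcal D$ have the same Turing degrees. (2) Depth is invariant neither under Turing equivalence nor under Muchnik equivalence: there are $\Pi^0_1$ classes $\mathcal C$ and $\mathcal D$ that have the same Turing degrees and are Muchnik equivalent, such that $\mathcal C$ is deep and $\mathcal D$ is not deep. (3) There is a negligible $\Pi^0_1$ class that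 is not deep. -/

import Mathlib

open scoped ENNReal Computability

noncomputable section

namespace Cantor

/-- Cantor space, the set of infinite binary sequences. Finite strings are `List Bool`. -/
abbrev Seq : Type := ℕ → Bool

/-- The string `X ↾ n` of the first `n` bits of `X`. -/
def restrict (X : Seq) (n : ℕ) : List Bool := List.ofFn fun i : Fin n => X i

/-- `σ` is a prefix of the sequence `X`. -/
def IsPrefix (σ : List Bool) (X : Seq) : Prop := restrict X σ.length = σ

/-- The cylinder of all sequences that have `σ` as a prefix. -/
def cylinder (σ : List Bool) : Set Seq := {X | IsPrefix σ X}

/-- The concatenation `σ⌢X` of a string and a sequence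
(`List.getD` returns its last argument at positions beyond the end of `σ`). -/
def concat (σ : List Bool) (X : Seq) : Seq := fun n => σ.getD n (X (n - σ.length))

/-- A `Π⁰₁` class: the complement of the union of the cylinders of a c.e. set of strings. -/
def IsPi01 (C : Set Seq) : Prop :=
  ∃ S : Set (List Bool), REPred (fun σ => σ ∈ S) ∧ C = (⋃ σ ∈ S, cylinder σ)ᶜ

/-- The canonical tree of a class: the strings whose cylinder meets the class. -/
def canonicalTree (C : Set Seq) : Set (List Bool) := {σ | (cylinder σ ∩ C).Nonempty}

/-- A continuous semi-measure. -/
structure IsSemimeasure (ρ : List Bool → ℝ) : Prop where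
  nonneg : ∀ σ, 0 ≤ ρ σ
  root : ρ [] = 1
  superadditive : ∀ σ, ρ (σ ++ [false]) + ρ (σ ++ [true]) ≤ ρ σ

/-- Lower semi-computability of a non-negative function on strings: it is the pointwise limit of
a non-decreasing computable sequence of dyadic rationals. The pair `(a, b)` of natural numbers
stands for the dyadic rational `a / 2 ^ b`. -/
def LowerSemicomputable (ρ : List Bool → ℝ) : Prop :=
  ∃ φ : List Bool → ℕ → ℕ × ℕ, Computable₂ φ ∧
    ∀ σ, Monotone (fun i => ((φ σ i).1 : ℝ) / 2 ^ (φ σ i).2) ∧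
      Filter.Tendsto (fun i => ((φ σ i).1 : ℝ) / 2 ^ (φ σ i).2) Filter.atTop (nhds (ρ σ))

/-- A universal lower semi-computable continuous semi-measure: it dominates, up to a
multiplicative constant, every lower semi-computable continuous semi-measure. -/
def IsUniversal (M : List Bool → ℝ) : Prop :=
  IsSemimeasure M ∧ LowerSemicomputable M ∧
    ∀ ρ : List Bool → ℝ, IsSemimeasure ρ → LowerSemicomputable ρ →
      ∃ c : ℕ, ∀ σ, ρ σ ≤ c * M σ

open Classical in
/-- `ρ(T_n)`, the sum of `ρ(σ)` over the strings `σ ∈ T` of length `n`. -/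
def levelSum (ρ : List Bool → ℝ) (T : Set (List Bool)) (n : ℕ) : ℝ :=
  ∑ v : Fin n → Bool, if List.ofFn v ∈ T then ρ (List.ofFn v) else 0

/-- A computable order: a computable, non-decreasing and unbounded function. -/
def IsComputableOrder (h : ℕ → ℕ) : Prop :=
  Computable h ∧ Monotone h ∧ ∀ k, ∃ n, k ≤ h n

/-- A class `C` with canonical tree `T` is deep if `M(T_n) ≤ 2^{-h(n)}` for all `n`, for some
computable order `h`. (Not `<`, which fails at `n = 0` for all non-empty classes
as `M` of the empty string is `1`.) -/
def Deep (M : List Bool → ℝ) (C : Set Seq) : Prop :=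
  ∃ h : ℕ → ℕ, IsComputableOrder h ∧
    ∀ n, levelSum M (canonicalTree C) n ≤ (2 : ℝ)⁻¹ ^ h n

/-- The value at the string `σ` of the measure derived from the semi-measure `ρ`: the infimum over
`k` of the sum of `ρ` over the extensions of `σ` of length `|σ| + k`. -/
def derived (ρ : List Bool → ℝ) (σ : List Bool) : ℝ :=
  ⨅ k : ℕ, ∑ v : Fin k → Bool, ρ (σ ++ List.ofFn v)

/-- The (Carathéodory) extension of the derived measure from strings to sets of sequences: the
infimum of the total weight of the coverings by cylinders. -/
def derivedMeasure (ρ : List Bool → ℝ) (A : Set Seq) : ℝ≥0∞ :=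
  ⨅ (S : Set (List Bool)) (_ : A ⊆ ⋃ σ ∈ S, cylinder σ), ∑' σ : S, ENNReal.ofReal (derived ρ σ)

/-- A class is negligible if it is null for the measure derived from `M`. -/
def Negligible (M : List Bool → ℝ) (C : Set Seq) : Prop := derivedMeasure M C = 0

/-- A sequence as a (total) function on the natural numbers. -/
def toPFun (X : Seq) : ℕ →. ℕ := fun n => Part.some (X n).toNat

/-- The members of `C` and of `D` have the same Turing degrees. -/
def SameTuringDegrees (C D : Set Seq) : Prop :=
  (∀ X ∈ C, ∃ Y ∈ D, toPFun X ≡ᵀ toPFun Y) ∧ ∀ Y ∈ D, ∃ X ∈ C, toPFun Y ≡ᵀ toPFun X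

/-- Muchnik reducibility: every member of `D` computes a member of `C`. -/
def MuchnikReducible (C D : Set Seq) : Prop := ∀ Y ∈ D, ∃ X ∈ C, toPFun X ≤ᵀ toPFun Y

/-- Muchnik equivalence. -/
def MuchnikEquivalent (C D : Set Seq) : Prop := MuchnikReducible C D ∧ MuchnikReducible D C

end Cantor

end

/-! A translate `σ⌢C` keeps the degrees of `C` but puts `σ` into the canonical tree. So depth is
destroyed by adjoining translates `σ⌢C` for strings `σ` that are too easy to compute to have small
`M`-weight.

Non-depth. For a number `k` coding a program `e`, wait for a first stage `s ≥ k` at which `e` is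
seen to take a value at least `2k + 2` at some `m ≤ s`, and adjoin the translate by one string of
length `s`. These strings are computable from the stages, so weight `2^-(k+1)` on the `k`-th of them
gives a lower semi-computable semi-measure and `M` is at least `2^-(k+1) / c` there
(`IsUniversal.exists_le_of_firstStage`). If `e` computed an order `h` witnessing depth, the prefix
of length `m` would give `M ≤ 2^-(2k+2)`. For `k = ⟨e, c⟩ ≥ c` this is absurd
(`Refutes.not_deep_nonDeepExtension`).

Effective closedness. The translating string of stage `s` is a string of length `s` not yet refuted
for `C` at stage `s`. A sequence outside `C` is refuted at some stage `n`, after which no such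
string is a prefix of it. Only finitely many translates remain to be excluded
(`Refutes.isPi01_withTranslates`).

A deep class. Cut the positions from 2 on into blocks of length `2^(j+1)`. While the strings obeying
the constraint on block `j` appear to have weight above `2^-j`, fix one more bit of the block so as
to discard the heavier half. Each step discards more than `2^-(j+1)` out of total weight at most 1,
so the block never runs out of bits and the final weight is at most `2^-j`
(`CodeFor.blockSum_constraint_le`, `CodeFor.exists_constraint_light`).

Negligibility. By universality `M(σ⌢η) ≤ c_σ M(η)`, so each translate of a deep class has covers of
arbitrarily small weight, and there are countably many translates
(`IsUniversal.negligible_of_tails`). Non-depth applied to a deep class thus yields (2) and (3)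
together.

A universal `M` is the usual mixture: each program's approximation is made superadditive, is frozen
if its mass would exceed 1, and is given weight `2^-(e+1)`. -/

noncomputable section

namespace Cantor

open Filter Topology Encodable Nat.Partrec

/-! ### Primitive recursive sums, maxima and bounded quantifiers -/

section PrimrecLemmas

variable {α β : Type*} [Primcodable α] [Primcodable β]

theorem primrec_sum_map {f : α → List β} {g : α → β → ℕ} (hf : Primrec f) (hg : Primrec₂ g) :
    Primrec fun a => ((f a).map (g a)).sum := by
  have h := Primrec.list_foldr (h := fun (_ : α) (p : ℕ × ℕ) => p.1 + p.2)
    (Primrec.list_map hf hg) (Primrec.const 0)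
    (Primrec.nat_add.comp (Primrec.fst.comp Primrec.snd) (Primrec.snd.comp Primrec.snd))
  exact h.of_eq fun a => by simp [List.sum]

theorem primrec_sup_map {f : α → List β} {g : α → β → ℕ} (hf : Primrec f) (hg : Primrec₂ g) :
    Primrec fun a => ((f a).map (g a)).foldr max 0 :=
  Primrec.list_foldr (h := fun (_ : α) (p : ℕ × ℕ) => max p.1 p.2)
    (Primrec.list_map hf hg) (Primrec.const 0)
    (Primrec.nat_max.comp (Primrec.fst.comp Primrec.snd) (Primrec.snd.comp Primrec.snd))

theorem primrec_pow : Primrec₂ ((· ^ ·) : ℕ → ℕ → ℕ) :=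
  Primrec₂.unpaired'.1 Nat.Primrec.pow

theorem primrec_two_pow {f : α → ℕ} (hf : Primrec f) : Primrec fun a => 2 ^ f a :=
  primrec_pow.comp (Primrec.const 2) hf

theorem primrecRel_prefix : PrimrecRel fun σ τ : List Bool => σ <+: τ := by
  have : PrimrecRel fun σ τ : List Bool => σ = τ.take σ.length :=
    Primrec.eq.comp Primrec.fst
      (Primrec.list_take.comp (Primrec.list_length.comp Primrec.fst) Primrec.snd)
  exact this.of_eq fun σ τ => List.prefix_iff_eq_take.symm

theorem PrimrecRel.exists_lt_bound {R : ℕ → α → Prop} (hR : PrimrecRel R) {f : α → ℕ}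
    (hf : Primrec f) : PrimrecPred fun a => ∃ x < f a, R x a :=
  PrimrecPred.of_eq (hR.exists_mem_list.comp (Primrec.list_range.comp hf) Primrec.id)
    fun a => by simp

theorem PrimrecRel.forall_lt_bound {R : ℕ → α → Prop} (hR : PrimrecRel R) {f : α → ℕ}
    (hf : Primrec f) : PrimrecPred fun a => ∀ x < f a, R x a :=
  PrimrecPred.of_eq (hR.forall_mem_list.comp (Primrec.list_range.comp hf) Primrec.id)
    fun a => by simp

theorem le_foldr_max {l : List ℕ} {x : ℕ} (h : x ∈ l) : x ≤ l.foldr max 0 := by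
  induction l with
  | nil => simp at h
  | cons a l ih =>
    rcases List.mem_cons.1 h with rfl | h
    · simp
    · exact (ih h).trans (by simp)

theorem foldr_max_mem {l : List ℕ} : l.foldr max 0 = 0 ∨ l.foldr max 0 ∈ l := by
  induction l with
  | nil => simp
  | cons a l ih =>
    simp only [List.foldr_cons, List.mem_cons]
    rcases le_total a (l.foldr max 0) with h | h
    · rw [max_eq_right h]; tauto
    · rw [max_eq_left h]; tauto

end PrimrecLemmas

/-! ### Strings of a given length -/

/-- The list of all strings of length `n`. -/
def allStrings (n : ℕ) : List (List Bool) :=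
  Nat.rec [[]] (fun _ l => l.flatMap fun σ => [σ ++ [false], σ ++ [true]]) n

theorem allStrings_succ (n : ℕ) :
    allStrings (n + 1) = (allStrings n).flatMap fun σ => [σ ++ [false], σ ++ [true]] := rfl

theorem primrec_allStrings : Primrec allStrings := by
  refine Primrec.nat_rec₁ _ ?_
  refine Primrec.list_flatMap Primrec.snd ?_
  have h (b : Bool) : Primrec₂ fun (_ : ℕ × List (List Bool)) (σ : List Bool) => σ ++ [b] :=
    Primrec.list_concat.comp Primrec.snd (Primrec.const b)
  exact Primrec.list_cons.comp (h false) (Primrec.list_cons.comp (h true) (Primrec.const []))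

theorem mem_allStrings {n : ℕ} {σ : List Bool} : σ ∈ allStrings n ↔ σ.length = n := by
  induction n generalizing σ with
  | zero => simp [allStrings]
  | succ n ih =>
    rw [allStrings_succ, List.mem_flatMap]
    constructor
    · rintro ⟨τ, hτ, h⟩
      have := ih.1 hτ
      simp at h
      rcases h with rfl | rfl <;> simp [this]
    · intro h
      rcases List.eq_nil_or_concat σ with rfl | ⟨τ, b, rfl⟩
      · simp at h
      · refine ⟨τ, ih.2 (by simpa using h), ?_⟩
        cases b <;> simp

theorem nodup_allStrings (n : ℕ) : (allStrings n).Nodup := by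
  induction n with
  | zero => simp [allStrings]
  | succ n ih =>
    rw [allStrings_succ, List.nodup_flatMap]
    refine ⟨fun σ _ => by simp, ih.imp ?_⟩
    intro σ τ h
    simp [Function.onFun, h.symm]

/-- The finset of all strings of length `n`. -/
def strings (n : ℕ) : Finset (List Bool) := (allStrings n).toFinset

@[simp]
theorem mem_strings {n : ℕ} {σ : List Bool} : σ ∈ strings n ↔ σ.length = n := by
  rw [strings, List.mem_toFinset, mem_allStrings]

theorem sum_strings_eq_list {A : Type*} [AddCommMonoid A] (f : List Bool → A) (n : ℕ) :
    ∑ σ ∈ strings n, f σ = ((allStrings n).map f).sum :=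
  List.sum_toFinset f (nodup_allStrings n)

theorem strings_zero : strings 0 = {[]} := by
  ext; simp

theorem sum_strings_succ {A : Type*} [AddCommMonoid A] (f : List Bool → A) (n : ℕ) :
    ∑ σ ∈ strings (n + 1), f σ = ∑ σ ∈ strings n, (f (σ ++ [false]) + f (σ ++ [true])) := by
  rw [sum_strings_eq_list, sum_strings_eq_list, allStrings_succ]
  induction allStrings n with
  | nil => simp
  | cons a l ih => 
    simp only [List.flatMap_cons, List.map_append, List.sum_append, ih, List.map_cons,
      List.sum_cons]
    simp

theorem sum_ofFn {A : Type*} [AddCommMonoid A] (f : List Bool → A) (n : ℕ) :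
    ∑ v : Fin n → Bool, f (List.ofFn v) = ∑ σ ∈ strings n, f σ := by
  refine Finset.sum_bij (fun v _ => List.ofFn v) (by simp) ?_ ?_ (fun _ _ => rfl)
  · intro a _ b _ h
    exact List.ofFn_injective h
  · intro σ hσ
    obtain rfl := mem_strings.1 hσ
    exact ⟨fun i => σ[i], Finset.mem_univ _, List.ofFn_getElem ..⟩

open Classical in
theorem levelSum_eq (ρ : List Bool → ℝ) (T : Set (List Bool)) (n : ℕ) :
    levelSum ρ T n = ∑ σ ∈ strings n, if σ ∈ T then ρ σ else 0 := by
  unfold levelSum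
  rw [← sum_ofFn]

/-! ### Semi-measures -/

theorem antitone_of_snoc {A : Type*} [Preorder A] {f : List Bool → A}
    (h : ∀ σ b, f (σ ++ [b]) ≤ f σ) (σ τ : List Bool) : f (σ ++ τ) ≤ f σ := by
  induction τ using List.reverseRecOn with
  | nil => simp
  | append_singleton τ b ih => rw [← List.append_assoc]; exact (h _ _).trans ih

theorem IsSemimeasure.snoc_le {ρ : List Bool → ℝ} (h : IsSemimeasure ρ) (σ : List Bool) (b : Bool) :
    ρ (σ ++ [b]) ≤ ρ σ := by
  have h1 := h.superadditive σ
  have h2 := h.nonneg (σ ++ [false])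
  have h3 := h.nonneg (σ ++ [true])
  cases b <;> linarith

theorem IsSemimeasure.anti {ρ : List Bool → ℝ} (h : IsSemimeasure ρ) {σ τ : List Bool}
    (hp : σ <+: τ) : ρ τ ≤ ρ σ := by
  obtain ⟨υ, rfl⟩ := hp
  exact antitone_of_snoc h.snoc_le σ υ

theorem IsSemimeasure.sum_strings_le {ρ : List Bool → ℝ} (h : IsSemimeasure ρ) (n : ℕ) :
    ∑ σ ∈ strings n, ρ σ ≤ 1 := by
  induction n with
  | zero => simp [strings_zero, h.root]
  | succ n ih =>
    rw [sum_strings_succ]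
    exact (Finset.sum_le_sum fun σ _ => h.superadditive σ).trans ih

/-! ### Approximation by codes -/

/-- The value with denominator `2 ^ s` that the code `c` yields for `(σ, i)` within `s` steps. -/
def codeValue (c : Code) (s : ℕ) (σ : List Bool) (i : ℕ) : ℕ :=
  ((Code.evaln s c (encode (σ, i))).map
    fun n => n.unpair.1 * 2 ^ s / 2 ^ n.unpair.2).getD 0

/-- The stage `s` approximation, with denominator `2 ^ s`, to the function on strings that is
lower semi-computed by the code `c`. -/
def codeApprox (c : Code) (s : ℕ) (σ : List Bool) : ℕ :=
  ((List.range s).map (codeValue c s σ)).foldr max 0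

theorem primrec_codeApprox :
    Primrec fun p : (Code × ℕ) × List Bool => codeApprox p.1.1 p.1.2 p.2 := by
  refine primrec_sup_map (Primrec.list_range.comp (Primrec.snd.comp Primrec.fst)) ?_
  refine Primrec.option_getD.comp (Primrec.option_map ?_ ?_)
    (Primrec.const 0)
  · refine Code.primrec_evaln.comp (Primrec.pair (Primrec.pair ?_ ?_) ?_)
    · exact Primrec.snd.comp (Primrec.fst.comp Primrec.fst)
    · exact Primrec.fst.comp (Primrec.fst.comp Primrec.fst)
    · exact Primrec.encode.comp (Primrec.pair (Primrec.snd.comp Primrec.fst) Primrec.snd)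
  · have hu := Primrec.unpair.comp (Primrec.snd (α := ((Code × ℕ) × List Bool) × ℕ) (β := ℕ))
    refine Primrec.nat_div.comp (Primrec.nat_mul.comp (Primrec.fst.comp hu) ?_) ?_
    · exact primrec_two_pow (Primrec.snd.comp (Primrec.fst.comp (Primrec.fst.comp Primrec.fst)))
    · exact primrec_two_pow (Primrec.snd.comp hu)

/-- A halted computation keeps its value, and `2⌊x⌋ ≤ ⌊2x⌋`. Doubling numerators is monotonicity
once the denominator is `2 ^ s`. -/
theorem two_mul_codeValue_le (c : Code) (s : ℕ) (σ : List Bool) (i : ℕ) :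
    2 * codeValue c s σ i ≤ codeValue c (s + 1) σ i := by
  unfold codeValue
  cases h : Code.evaln s c (encode (σ, i)) with
  | none => simp
  | some n =>
    have h' : Code.evaln (s + 1) c (encode (σ, i)) = some n :=
      Code.evaln_mono s.le_succ h
    rw [h']
    simp only [Option.map_some, Option.getD_some]
    rw [pow_succ, ← mul_assoc, mul_comm _ 2]
    exact Nat.mul_div_le_mul_div_assoc _ _ _

theorem two_mul_codeApprox_le (c : Code) (s : ℕ) (σ : List Bool) :
    2 * codeApprox c s σ ≤ codeApprox c (s + 1) σ := by
  rcases foldr_max_mem (l := (List.range s).map (codeValue c s σ)) with h | h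
  · unfold codeApprox; rw [h]; simp
  · obtain ⟨i, hi, h⟩ := List.mem_map.1 h
    unfold codeApprox
    rw [← h]
    refine (two_mul_codeValue_le c s σ i).trans (le_foldr_max (List.mem_map.2 ⟨i, ?_, rfl⟩))
    simp at hi ⊢
    omega

theorem exists_code {φ : List Bool → ℕ → ℕ × ℕ} (hφ : Computable₂ φ) :
    ∃ c : Code, ∀ σ i, Nat.pair (φ σ i).1 (φ σ i).2 ∈ Code.eval c (encode (σ, i)) := by
  obtain ⟨c, hc⟩ := Code.exists_code.1 hφ
  refine ⟨c, fun σ i => ?_⟩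
  rw [hc]
  simp only [encodek, Part.coe_some, Part.bind_some, PFun.coe_val, Part.map_some, Part.mem_some_iff]
  rfl

/-- `c` is a code for an approximation that lower semi-computes `ρ`. -/
def CodeFor (c : Code) (ρ : List Bool → ℝ) : Prop :=
  ∀ σ, (∀ s, (codeApprox c s σ : ℝ) / 2 ^ s ≤ ρ σ) ∧
    Tendsto (fun s => (codeApprox c s σ : ℝ) / 2 ^ s) atTop (𝓝 (ρ σ))

theorem LowerSemicomputable.exists_codeFor {ρ : List Bool → ℝ} (h : LowerSemicomputable ρ)
    (h0 : ∀ σ, 0 ≤ ρ σ) : ∃ c, CodeFor c ρ := by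
  obtain ⟨φ, hφ, hlim⟩ := h
  obtain ⟨c, hc⟩ := exists_code hφ
  refine ⟨c, fun σ => ?_⟩
  obtain ⟨hm, ht⟩ := hlim σ
  have hle (i : ℕ) : ((φ σ i).1 : ℝ) / 2 ^ (φ σ i).2 ≤ ρ σ := hm.ge_of_tendsto ht i
  have hval (s i n : ℕ) (hn : Code.evaln s c (encode (σ, i)) = some n) :
      n = Nat.pair (φ σ i).1 (φ σ i).2 :=
    Part.mem_unique (Code.evaln_sound hn) (hc σ i)
  have hup (s i : ℕ) : (codeValue c s σ i : ℝ) / 2 ^ s ≤ ρ σ := by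
    unfold codeValue
    cases h : Code.evaln s c (encode (σ, i)) with
    | none => simp [h0]
    | some n =>
      obtain rfl := hval s i n h
      simp only [Option.map_some, Option.getD_some, Nat.unpair_pair]
      refine le_trans ?_ (hle i)
      rw [div_le_iff₀ (by positivity), div_mul_eq_mul_div]
      refine Nat.cast_div_le.trans ?_
      push_cast
      rfl
  have hup' (s : ℕ) : (codeApprox c s σ : ℝ) / 2 ^ s ≤ ρ σ := by
    rcases foldr_max_mem (l := (List.range s).map (codeValue c s σ)) with h | h
    · unfold codeApprox; rw [h]; simp [h0]
    · obtain ⟨i, hi, h⟩ := List.mem_map.1 h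
      unfold codeApprox
      rw [← h]
      exact hup s i
  refine ⟨hup', ?_⟩
  rw [Metric.tendsto_atTop]
  intro ε hε
  obtain ⟨i, hi⟩ := (ht.eventually (lt_mem_nhds (show ρ σ - ε / 2 < ρ σ by linarith))).exists
  obtain ⟨k, hk⟩ := Code.evaln_complete.1 (hc σ i)
  -- Half of `ε` pays for the choice of `i`, the other half for rounding down to denominator `2 ^
  -- s`.
  obtain ⟨m, hm'⟩ := exists_pow_lt_of_lt_one (half_pos hε) (show (1 / 2 : ℝ) < 1 by norm_num)
  refine ⟨max (max k (i + 1)) m, fun s hs => ?_⟩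
  have hks : k ≤ s := by omega
  have his : i < s := by omega
  have hms : m ≤ s := by omega
  have h1 : codeValue c s σ i ≤ codeApprox c s σ :=
    le_foldr_max (List.mem_map.2 ⟨i, by simpa using his, rfl⟩)
  have h2 : codeValue c s σ i = (φ σ i).1 * 2 ^ s / 2 ^ (φ σ i).2 := by
    unfold codeValue
    rw [Option.mem_def.1 (Code.evaln_mono hks hk)]
    simp only [Option.map_some, Option.getD_some, Nat.unpair_pair]
  have h3 : ((φ σ i).1 : ℝ) * 2 ^ s / 2 ^ (φ σ i).2 ≤ codeApprox c s σ + 1 := by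
    have := (Nat.lt_floor_add_one (((φ σ i).1 : ℝ) * 2 ^ s / 2 ^ (φ σ i).2)).le
    refine this.trans ?_
    have e : ⌊((φ σ i).1 : ℝ) * 2 ^ s / 2 ^ (φ σ i).2⌋₊ = codeValue c s σ i := by
      rw [h2, ← Nat.floor_div_eq_div (K := ℝ)]
      push_cast
      rfl
    rw [e]
    exact_mod_cast Nat.succ_le_succ h1
  have h4 : ((φ σ i).1 : ℝ) / 2 ^ (φ σ i).2 ≤ codeApprox c s σ / 2 ^ s + (1 / 2) ^ s := by
    rw [one_div, inv_pow, ← one_div, ← add_div, le_div_iff₀ (by positivity),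
      div_mul_eq_mul_div]
    exact h3
  have h5 : (1 / 2 : ℝ) ^ s ≤ (1 / 2) ^ m :=
    pow_le_pow_of_le_one (by norm_num) (by norm_num) hms
  rw [Real.dist_eq, abs_lt]
  constructor <;> [linarith; linarith [hup' s]]

/-! ### Semi-measures from approximations -/

/-- A primitive recursive approximation, with denominator `2 ^ s` at stage `s`,
to a semi-measure. -/
structure IsApprox (N : List Bool → ℕ → ℕ) : Prop where
  primrec : Primrec₂ N
  double : ∀ σ s, 2 * N σ s ≤ N σ (s + 1)
  superadditive : ∀ σ s, N (σ ++ [false]) s + N (σ ++ [true]) s ≤ N σ s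
  root : ∀ s, N [] s ≤ 2 ^ s

theorem monotone_div_of_double {N : ℕ → ℕ} (h : ∀ s, 2 * N s ≤ N (s + 1)) :
    Monotone fun s => (N s : ℝ) / 2 ^ s := by
  refine monotone_nat_of_le_succ fun s => ?_
  have : (2 * N s : ℝ) ≤ N (s + 1) := by exact_mod_cast h s
  rw [div_le_div_iff₀ (by positivity) (by positivity), pow_succ]
  nlinarith [pow_pos (show (0 : ℝ) < 2 by norm_num) s]

theorem IsApprox.exists_semimeasure {N : List Bool → ℕ → ℕ} (h : IsApprox N) :
    ∃ ρ, IsSemimeasure ρ ∧ LowerSemicomputable ρ ∧ ∀ σ s, (N σ s : ℝ) / 2 ^ s ≤ ρ σ := by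
  have hmono (σ) := monotone_div_of_double (h.double σ)
  have hroot (σ s) : N σ s ≤ 2 ^ s := by
    refine le_trans ?_ (h.root s)
    refine antitone_of_snoc (f := fun σ => N σ s) (fun σ b => ?_) [] σ
    have := h.superadditive σ s
    cases b <;> omega
  have hone (σ s) : (N σ s : ℝ) / 2 ^ s ≤ 1 := by
    rw [div_le_one (by positivity)]
    exact_mod_cast hroot σ s
  have hbdd (σ) : BddAbove (Set.range fun s => (N σ s : ℝ) / 2 ^ s) :=
    ⟨1, by rintro _ ⟨s, rfl⟩; exact hone σ s⟩
  have htend (σ) : Tendsto (fun s => (N σ s : ℝ) / 2 ^ s) atTop (𝓝 (⨆ s, (N σ s : ℝ) / 2 ^ s)) :=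
    tendsto_atTop_ciSup (hmono σ) (hbdd σ)
  have hsup (σ) : (⨆ s, (N (σ ++ [false]) s : ℝ) / 2 ^ s) + (⨆ s, (N (σ ++ [true]) s : ℝ) / 2 ^ s)
      ≤ ⨆ s, (N σ s : ℝ) / 2 ^ s := by
    refine le_of_tendsto_of_tendsto' ((htend _).add (htend _)) (htend σ) fun s => ?_
    rw [← add_div]
    gcongr
    exact_mod_cast h.superadditive σ s
  -- The root is reset to 1, since the approximations only guarantee a root value of at most 1. This
  -- preserves superadditivity and computability.
  refine ⟨fun σ => if σ = [] then 1 else ⨆ s, (N σ s : ℝ) / 2 ^ s, ⟨?_, ?_, ?_⟩, ?_, ?_⟩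
  · intro σ
    split_ifs
    · exact zero_le_one
    · exact Real.iSup_nonneg fun s => by positivity
  · simp
  · intro σ
    have e (b : Bool) : σ ++ [b] ≠ [] := by simp
    simp only [e, if_false]
    split_ifs
    · exact (hsup σ).trans (ciSup_le (hone σ))
    · exact hsup σ
  · refine ⟨fun σ s => if σ = [] then (1, 0) else (N σ s, s), ?_, fun σ => ?_⟩
    · refine Primrec.to_comp (Primrec.ite (Primrec.eq.comp Primrec.fst (Primrec.const []))
        (Primrec.const (1, 0)) (Primrec.pair ?_ Primrec.snd))
      exact h.primrec
    · by_cases hσ : σ = []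
      · simp [hσ, monotone_const]
      · simp only [hσ, if_false]
        exact ⟨hmono σ, htend σ⟩
  · intro σ s
    beta_reduce
    split_ifs
    · exact hone σ s
    · exact le_ciSup (hbdd σ) s

/-! ### A universal semi-measure -/

/-- The least superadditive majorant of `N`, with recursion depth `d`. -/
def majorant (N : List Bool → ℕ) : ℕ → List Bool → ℕ
  | 0, _ => 0
  | d + 1, σ => max (N σ) (majorant N d (σ ++ [false]) + majorant N d (σ ++ [true]))

/-- Both recursive calls also change the string, so the recursion runs on pairs of depth and string,
with the depth as its measure. -/
theorem primrec_majorant : Primrec₂ fun (p : Code × ℕ) (b : ℕ × List Bool) =>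
    majorant (codeApprox p.1 p.2) b.1 b.2 := by
  refine Primrec.nat_omega_rec (fun (p : Code × ℕ) (b : ℕ × List Bool) =>
    majorant (codeApprox p.1 p.2) b.1 b.2) (m := fun _ b => b.1)
    (l := fun _ b => if b.1 = 0 then [] else
      [(b.1 - 1, b.2 ++ [false]), (b.1 - 1, b.2 ++ [true])])
    (g := fun p q => some (if q.1.1 = 0 then 0 else
      max (codeApprox p.1 p.2 q.1.2) (q.2.getD 0 0 + q.2.getD 1 0))) ?_ ?_ ?_ ?_ ?_
  · exact Primrec.fst.comp Primrec.snd
  · have h (b : Bool) : Primrec fun p : (Code × ℕ) × ℕ × List Bool =>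
        (p.2.1 - 1, p.2.2 ++ [b]) :=
      Primrec.pair (Primrec.pred.comp (Primrec.fst.comp Primrec.snd))
        (Primrec.list_concat.comp (Primrec.snd.comp Primrec.snd) (Primrec.const b))
    exact Primrec.ite (Primrec.eq.comp (Primrec.fst.comp Primrec.snd) (Primrec.const 0))
      (Primrec.const []) (Primrec.list_cons.comp (h false)
        (Primrec.list_cons.comp (h true) (Primrec.const [])))
  · refine Primrec.option_some.comp (Primrec.ite (Primrec.eq.comp
      (Primrec.fst.comp (Primrec.fst.comp Primrec.snd)) (Primrec.const 0)) (Primrec.const 0)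
      (Primrec.nat_max.comp ?_ (Primrec.nat_add.comp ?_ ?_)))
    · exact primrec_codeApprox.comp (Primrec.pair Primrec.fst
        (Primrec.snd.comp (Primrec.fst.comp Primrec.snd)))
    · exact (Primrec.list_getD 0).comp (Primrec.snd.comp Primrec.snd) (Primrec.const 0)
    · exact (Primrec.list_getD 0).comp (Primrec.snd.comp Primrec.snd) (Primrec.const 1)
  · rintro p ⟨d, σ⟩ b' hb'
    cases d with
    | zero => simp at hb'
    | succ d =>
      simp at hb'
      rcases hb' with rfl | rfl <;> simp
  · rintro p ⟨d, σ⟩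
    cases d <;> simp [majorant]

theorem two_mul_majorant_le {N N' : List Bool → ℕ} (h : ∀ σ, 2 * N σ ≤ N' σ) {d d' : ℕ}
    (hd : d ≤ d') (σ : List Bool) : 2 * majorant N d σ ≤ majorant N' d' σ := by
  induction d generalizing d' σ with
  | zero => simp [majorant]
  | succ d ih =>
    obtain ⟨d', rfl⟩ : ∃ k, d' = k + 1 := ⟨d' - 1, by omega⟩
    have h0 := ih (show d ≤ d' by omega) (σ ++ [false])
    have h1 := ih (show d ≤ d' by omega) (σ ++ [true])
    have h2 := h σ
    simp only [majorant]
    omega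

/-- A semi-measure is itself superadditive, so closing a lower bound for it under superadditivity
never overshoots it. -/
theorem majorant_le {N : List Bool → ℕ} {ρ : List Bool → ℝ} (h : IsSemimeasure ρ) {s : ℕ}
    (hN : ∀ σ, (N σ : ℝ) / 2 ^ s ≤ ρ σ) (d : ℕ) (σ : List Bool) :
    (majorant N d σ : ℝ) / 2 ^ s ≤ ρ σ := by
  induction d generalizing σ with
  | zero => simpa [majorant] using h.nonneg σ
  | succ d ih =>
    rw [majorant, Nat.cast_max, ← max_div_div_right (by positivity : (0 : ℝ) ≤ 2 ^ s), max_le_iff]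
    refine ⟨hN σ, ?_⟩
    push_cast
    rw [add_div]
    exact (add_le_add (ih _) (ih _)).trans (h.superadditive σ)

/-- The superadditive majorant of the approximation at stage `s` of the code `c`, restricted to
strings of length at most `s`. -/
def codeMajorant (c : Code) (s : ℕ) (σ : List Bool) : ℕ :=
  majorant (codeApprox c s) (s + 1 - σ.length) σ

theorem primrec_codeMajorant :
    Primrec fun p : (Code × ℕ) × List Bool => codeMajorant p.1.1 p.1.2 p.2 := by
  refine primrec_majorant.comp Primrec.fst (Primrec.pair (Primrec.nat_sub.comp
    (Primrec.succ.comp (Primrec.snd.comp Primrec.fst))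
    (Primrec.list_length.comp Primrec.snd)) Primrec.snd)

/-- Up to length `s`, depth and length add up to `s + 1`, so the children carry exactly the depth of
the recursive calls; beyond that the children have value 0. -/
theorem codeMajorant_superadditive (c : Code) (s : ℕ) (σ : List Bool) :
    codeMajorant c s (σ ++ [false]) + codeMajorant c s (σ ++ [true]) ≤ codeMajorant c s σ := by
  unfold codeMajorant
  simp only [List.length_append, List.length_singleton]
  rcases Nat.lt_or_ge s σ.length with h | h
  · rw [show s + 1 - (σ.length + 1) = 0 by omega]
    simp [majorant]
  · rw [show s + 1 - (σ.length + 1) = s - σ.length by omega,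
      show s + 1 - σ.length = s - σ.length + 1 by omega]
    exact le_max_right _ _

theorem two_mul_codeMajorant_le (c : Code) (s : ℕ) (σ : List Bool) :
    2 * codeMajorant c s σ ≤ codeMajorant c (s + 1) σ :=
  two_mul_majorant_le (two_mul_codeApprox_le c s) (by omega) σ

theorem codeApprox_le_codeMajorant {c : Code} {s : ℕ} {σ : List Bool} (h : σ.length ≤ s) :
    codeApprox c s σ ≤ codeMajorant c s σ := by
  unfold codeMajorant
  rw [show s + 1 - σ.length = s - σ.length + 1 by omega]
  exact le_max_left _ _

/-- The approximation `codeMajorant` frozen as soon as its value at the root exceeds `1`. -/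
def trimmed (c : Code) (σ : List Bool) (s : ℕ) : ℕ :=
  Nat.rec 0 (fun s v => if codeMajorant c (s + 1) [] ≤ 2 ^ (s + 1) then codeMajorant c (s + 1) σ
    else 2 * v) s

theorem trimmed_succ (c : Code) (σ : List Bool) (s : ℕ) : trimmed c σ (s + 1) =
    if codeMajorant c (s + 1) [] ≤ 2 ^ (s + 1) then codeMajorant c (s + 1) σ
    else 2 * trimmed c σ s := rfl

theorem primrec_trimmed :
    Primrec fun p : (Code × List Bool) × ℕ => trimmed p.1.1 p.1.2 p.2 := by
  refine Primrec.nat_rec' (h := fun (p : (Code × List Bool) × ℕ) (q : ℕ × ℕ) =>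
    if codeMajorant p.1.1 (q.1 + 1) [] ≤ 2 ^ (q.1 + 1) then codeMajorant p.1.1 (q.1 + 1) p.1.2
    else 2 * q.2) Primrec.snd (Primrec.const 0) (Primrec.ite ?_ ?_ ?_)
  · refine Primrec.nat_le.comp (primrec_codeMajorant.comp (Primrec.pair (Primrec.pair ?_ ?_)
      (Primrec.const []))) (primrec_two_pow ?_)
    · exact Primrec.fst.comp (Primrec.fst.comp Primrec.fst)
    · exact Primrec.succ.comp (Primrec.fst.comp Primrec.snd)
    · exact Primrec.succ.comp (Primrec.fst.comp Primrec.snd)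
  · refine primrec_codeMajorant.comp (Primrec.pair (Primrec.pair ?_ ?_) ?_)
    · exact Primrec.fst.comp (Primrec.fst.comp Primrec.fst)
    · exact Primrec.succ.comp (Primrec.fst.comp Primrec.snd)
    · exact Primrec.snd.comp (Primrec.fst.comp Primrec.fst)
  · exact Primrec.nat_mul.comp (Primrec.const 2) (Primrec.snd.comp Primrec.snd)

theorem trimmed_le (c : Code) (σ : List Bool) (s : ℕ) : trimmed c σ s ≤ codeMajorant c s σ := by
  induction s with
  | zero => exact Nat.zero_le _
  | succ s ih =>
    rw [trimmed_succ]
    split_ifs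
    · exact le_rfl
    · exact (Nat.mul_le_mul_left 2 ih).trans (two_mul_codeMajorant_le c s σ)

theorem two_mul_trimmed_le (c : Code) (σ : List Bool) (s : ℕ) :
    2 * trimmed c σ s ≤ trimmed c σ (s + 1) := by
  rw [trimmed_succ]
  split_ifs
  · exact (Nat.mul_le_mul_left 2 (trimmed_le c σ s)).trans (two_mul_codeMajorant_le c s σ)
  · exact le_rfl

theorem trimmed_superadditive (c : Code) (σ : List Bool) (s : ℕ) :
    trimmed c (σ ++ [false]) s + trimmed c (σ ++ [true]) s ≤ trimmed c σ s := by
  induction s with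
  | zero => exact le_rfl
  | succ s ih =>
    simp only [trimmed_succ]
    split_ifs
    · exact codeMajorant_superadditive c _ σ
    · omega

theorem trimmed_root (c : Code) (s : ℕ) : trimmed c [] s ≤ 2 ^ s := by
  induction s with
  | zero => exact Nat.zero_le _
  | succ s ih =>
    simp only [trimmed_succ]
    split_ifs with h
    · exact h
    · rw [pow_succ]; omega

/-- For a code of a genuine semi-measure the majorant at the root is at most 1, so the freezing
never happens. -/
theorem CodeFor.codeApprox_le_trimmed {c : Code} {ρ : List Bool → ℝ} (hc : CodeFor c ρ)
    (hρ : IsSemimeasure ρ) {σ : List Bool} {s : ℕ} (hs : 0 < s) (h : σ.length ≤ s) :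
    codeApprox c s σ ≤ trimmed c σ s := by
  obtain ⟨s, rfl⟩ : ∃ k, s = k + 1 := ⟨s - 1, by omega⟩
  rw [trimmed_succ, if_pos]
  · exact codeApprox_le_codeMajorant h
  · have := majorant_le hρ (fun τ => (hc τ).1 (s + 1)) (s + 1 + 1 - ([] : List Bool).length) []
    rw [hρ.root, div_le_one (by positivity)] at this
    exact_mod_cast this

/-- The mixture of the trimmed approximations of all codes. -/
def universalApprox (σ : List Bool) (s : ℕ) : ℕ :=
  ((List.range s).map fun e => trimmed (Denumerable.ofNat Code e) σ s / 2 ^ (e + 1)).sum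

theorem universalApprox_eq (σ : List Bool) (s : ℕ) : universalApprox σ s =
    ∑ e ∈ Finset.range s, trimmed (Denumerable.ofNat Code e) σ s / 2 ^ (e + 1) := rfl

/-- The geometric sum telescopes; the summand `2 ^ (s - k)` is the mass still unspent, which the
induction needs. -/
theorem sum_two_pow_div_le (s k : ℕ) (h : k ≤ s) :
    ∑ e ∈ Finset.range k, 2 ^ s / 2 ^ (e + 1) + 2 ^ (s - k) ≤ 2 ^ s := by
  induction k with
  | zero => simp
  | succ k ih =>
    rw [Finset.sum_range_succ, Nat.pow_div h (by norm_num)]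
    have := ih (by omega)
    rw [show s - k = s - (k + 1) + 1 by omega, pow_succ] at this
    omega

theorem isApprox_universalApprox : IsApprox universalApprox where
  primrec := by
    refine primrec_sum_map (f := fun p : List Bool × ℕ => List.range p.2)
      (g := fun p e => trimmed (Denumerable.ofNat Code e) p.1 p.2 / 2 ^ (e + 1))
      (Primrec.list_range.comp Primrec.snd) ?_
    refine Primrec.nat_div.comp (primrec_trimmed.comp (Primrec.pair (Primrec.pair ?_ ?_) ?_))
      (primrec_two_pow (Primrec.succ.comp Primrec.snd))
    · exact (Primrec.ofNat Code).comp Primrec.snd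
    · exact Primrec.fst.comp Primrec.fst
    · exact Primrec.snd.comp Primrec.fst
  double σ s := by
    rw [universalApprox_eq, universalApprox_eq, Finset.mul_sum, Finset.sum_range_succ]
    refine le_trans (Finset.sum_le_sum fun e _ => ?_) (Nat.le_add_right _ _)
    exact (Nat.mul_div_le_mul_div_assoc _ _ _).trans
      (Nat.div_le_div_right (two_mul_trimmed_le _ σ s))
  superadditive σ s := by
    rw [universalApprox_eq, universalApprox_eq, universalApprox_eq, ← Finset.sum_add_distrib]
    refine Finset.sum_le_sum fun e _ => ?_
    exact (Nat.div_add_div_le_add_div).trans (Nat.div_le_div_right (trimmed_superadditive _ σ s))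
  root s := by
    rw [universalApprox_eq]
    refine (Finset.sum_le_sum fun e _ => Nat.div_le_div_right (trimmed_root _ s)).trans ?_
    exact (Nat.le_add_right _ _).trans (sum_two_pow_div_le s s le_rfl)

theorem exists_universal : ∃ M : List Bool → ℝ, IsUniversal M := by
  obtain ⟨M, hM, hlsc, hle⟩ := isApprox_universalApprox.exists_semimeasure
  refine ⟨M, hM, hlsc, fun ρ hρ hρlsc => ?_⟩
  obtain ⟨c, hc⟩ := hρlsc.exists_codeFor hρ.nonneg
  obtain ⟨e, rfl⟩ : ∃ e, c = Denumerable.ofNat Code e := ⟨encode c, by simp⟩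
  refine ⟨2 ^ (e + 1), fun σ => ?_⟩
  have key (s : ℕ) (hs : max (e + 1) σ.length ≤ s) :
      (codeApprox (Denumerable.ofNat Code e) s σ : ℝ) / 2 ^ s ≤
        2 ^ (e + 1) * M σ + 2 ^ (e + 1) * (1 / 2) ^ s := by
    have h1 := hc.codeApprox_le_trimmed hρ (show 0 < s by omega) (show σ.length ≤ s by omega)
    have h2 : trimmed (Denumerable.ofNat Code e) σ s / 2 ^ (e + 1) ≤ universalApprox σ s := by
      rw [universalApprox_eq]
      exact Finset.single_le_sum
        (f := fun e => trimmed (Denumerable.ofNat Code e) σ s / 2 ^ (e + 1))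
        (fun _ _ => Nat.zero_le _) (Finset.mem_range.2 (by omega))
    -- The summand `2 ^ (e + 1)` is the loss from integer division. Divided by `2 ^ s` it vanishes
    -- in the limit.
    have h3 : codeApprox (Denumerable.ofNat Code e) s σ ≤
        2 ^ (e + 1) * universalApprox σ s + 2 ^ (e + 1) := by
      have := Nat.lt_mul_div_succ (trimmed (Denumerable.ofNat Code e) σ s)
        (show 0 < 2 ^ (e + 1) by positivity)
      nlinarith [Nat.mul_le_mul_left (2 ^ (e + 1)) h2]
    have h4 : (codeApprox (Denumerable.ofNat Code e) s σ : ℝ) ≤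
        2 ^ (e + 1) * universalApprox σ s + 2 ^ (e + 1) := by exact_mod_cast h3
    have h5 := hle σ s
    calc (codeApprox (Denumerable.ofNat Code e) s σ : ℝ) / 2 ^ s
        ≤ (2 ^ (e + 1) * universalApprox σ s + 2 ^ (e + 1)) / 2 ^ s := by gcongr
      _ = 2 ^ (e + 1) * (universalApprox σ s / 2 ^ s) + 2 ^ (e + 1) * (1 / 2) ^ s := by
        rw [one_div, inv_pow]; ring
      _ ≤ _ := by gcongr
  have hlim : Tendsto (fun s : ℕ => (2 : ℝ) ^ (e + 1) * M σ + 2 ^ (e + 1) * (1 / 2) ^ s) atTop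
      (𝓝 (2 ^ (e + 1) * M σ + 2 ^ (e + 1) * 0)) :=
    tendsto_const_nhds.add ((tendsto_pow_atTop_nhds_zero_of_lt_one (by norm_num)
      (by norm_num)).const_mul _)
  have := le_of_tendsto_of_tendsto (hc σ).2 hlim (eventually_atTop.2 ⟨_, key⟩)
  push_cast
  linarith

/-! ### Sequences and strings -/

@[simp]
theorem length_restrict (X : Seq) (n : ℕ) : (restrict X n).length = n := by
  simp [restrict]

theorem restrict_add (X : Seq) (m n : ℕ) :
    restrict X (m + n) = restrict X m ++ restrict (fun i => X (m + i)) n := by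
  refine List.ext_getElem (by simp) fun i h1 h2 => ?_
  simp only [restrict, List.getElem_append, List.getElem_ofFn, List.length_ofFn]
  split_ifs with h
  · rfl
  · rw [Nat.add_sub_cancel' (not_lt.1 h)]

theorem restrict_prefix (X : Seq) {m n : ℕ} (h : m ≤ n) : restrict X m <+: restrict X n := by
  obtain ⟨k, rfl⟩ := Nat.exists_eq_add_of_le h
  rw [restrict_add]
  exact List.prefix_append _ _

theorem take_restrict (X : Seq) {m n : ℕ} (h : m ≤ n) : (restrict X n).take m = restrict X m := by
  have := List.prefix_iff_eq_take.1 (restrict_prefix X h)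
  rw [length_restrict] at this
  exact this.symm

theorem mem_cylinder {σ : List Bool} {X : Seq} : X ∈ cylinder σ ↔ restrict X σ.length = σ :=
  Iff.rfl

theorem mem_cylinder_restrict (X : Seq) (n : ℕ) : X ∈ cylinder (restrict X n) := by
  rw [mem_cylinder, length_restrict]

theorem prefix_restrict_iff {σ : List Bool} {X : Seq} {n : ℕ} (h : σ.length ≤ n) :
    σ <+: restrict X n ↔ X ∈ cylinder σ := by
  rw [List.prefix_iff_eq_take, take_restrict X h, mem_cylinder, eq_comm]

theorem cylinder_anti {σ τ : List Bool} (h : σ <+: τ) : cylinder τ ⊆ cylinder σ := by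
  intro X hX
  rw [← prefix_restrict_iff h.length_le, mem_cylinder.1 hX]
  exact h

theorem concat_add (σ : List Bool) (X : Seq) (i : ℕ) : concat σ X (σ.length + i) = X i := by
  simp [concat]

theorem restrict_concat (σ : List Bool) (X : Seq) (n : ℕ) :
    restrict (concat σ X) (σ.length + n) = σ ++ restrict X n := by
  rw [restrict_add]
  congr 1
  · refine List.ext_getElem (by simp) fun i h1 h2 => ?_
    simp [restrict, concat]
  · simp [concat_add]

theorem concat_mem_cylinder (σ : List Bool) (X : Seq) : concat σ X ∈ cylinder σ := by
  have h := restrict_concat σ X 0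
  rw [show restrict X 0 = [] from rfl, List.append_nil] at h
  exact h

theorem concat_restrict (X : Seq) (n : ℕ) : concat (restrict X n) (fun i => X (n + i)) = X := by
  funext i
  unfold concat
  rw [List.getD_eq_getElem?_getD, length_restrict]
  rcases Nat.lt_or_ge i n with h | h
  · simp [restrict, h]
  · rw [List.getElem?_eq_none (by simpa using h)]
    simp [Nat.add_sub_cancel' h]

theorem concat_nil (X : Seq) : concat [] X = X := by
  funext i
  simp [concat]

/-! ### Turing equivalence of sequences with the same tail -/

theorem toPFun_turingReducible_concat (σ : List Bool) (X : Seq) :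
    toPFun X ≤ᵀ toPFun (concat σ X) := by
  rw [TuringReducible, RecursiveIn.iff_nat]
  have h1 : Nat.RecursiveIn {toPFun (concat σ X)} (fun n : ℕ => (σ.length + n : ℕ)) :=
    Nat.Primrec.recursiveIn (Primrec.nat_iff.1 (Primrec.nat_add.comp (Primrec.const _) Primrec.id))
  have h2 : Nat.RecursiveIn {toPFun (concat σ X)} (toPFun (concat σ X)) :=
    Nat.RecursiveIn.oracle _ rfl
  refine (Nat.RecursiveIn.comp h2 h1).of_eq fun n => ?_
  refine (Part.bind_some (σ.length + n) (toPFun (concat σ X))).trans ?_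
  simp only [toPFun, concat_add]

theorem concat_turingReducible (σ : List Bool) (X : Seq) :
    toPFun (concat σ X) ≤ᵀ toPFun X := by
  rw [TuringReducible, RecursiveIn.iff_nat]
  have h1 : Nat.RecursiveIn {toPFun X} (fun n : ℕ => (n - σ.length : ℕ)) :=
    Nat.Primrec.recursiveIn (Primrec.nat_iff.1 (Primrec.nat_sub.comp Primrec.id (Primrec.const _)))
  have h2 : Nat.RecursiveIn {toPFun X} (toPFun X) := Nat.RecursiveIn.oracle _ rfl
  have h3 : Nat.RecursiveIn {toPFun X} (fun n : ℕ => (n : ℕ)) :=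
    Nat.Primrec.recursiveIn (Primrec.nat_iff.1 Primrec.id)
  -- Given a position paired with an oracle answer, look the position up in `σ` and fall back on the
  -- answer. At positions inside `σ` the truncated subtraction queries the oracle at 0 and the
  -- answer is ignored.
  have h4 : Primrec fun n : ℕ => ((σ.map Bool.toNat).getD n.unpair.1 n.unpair.2) := by
    refine (Primrec.option_getD.comp ((Primrec.list_getElem?₁ (σ.map Bool.toNat)).comp
      (Primrec.fst.comp Primrec.unpair)) (Primrec.snd.comp Primrec.unpair)).of_eq fun n => ?_
    rw [List.getD_eq_getElem?_getD]
  have h5 := Nat.Primrec.recursiveIn (O := {toPFun X}) (Primrec.nat_iff.1 h4)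
  refine (Nat.RecursiveIn.comp h5 (Nat.RecursiveIn.pair h3 (Nat.RecursiveIn.comp h2 h1))).of_eq
    fun n => ?_
  have e : (Part.some (n - σ.length) >>= toPFun X) = Part.some (X (n - σ.length)).toNat :=
    Part.bind_some _ _
  simp only [Part.coe_some, e]
  simp [toPFun, concat, Seq.seq]

theorem concat_turingEquivalent (σ : List Bool) (X : Seq) :
    toPFun (concat σ X) ≡ᵀ toPFun X :=
  ⟨concat_turingReducible σ X, toPFun_turingReducible_concat σ X⟩

theorem sameTuringDegrees_of_tails {C D : Set Seq} (h : C ⊆ D)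
    (h' : ∀ Y ∈ D, ∃ σ : List Bool, ∃ X ∈ C, Y = concat σ X) : SameTuringDegrees C D := by
  refine ⟨fun X hX => ⟨X, h hX, AntisymmRel.refl _ _⟩, fun Y hY => ?_⟩
  obtain ⟨σ, X, hX, rfl⟩ := h' Y hY
  exact ⟨X, hX, concat_turingEquivalent σ X⟩

theorem SameTuringDegrees.muchnikEquivalent {C D : Set Seq} (h : SameTuringDegrees C D) :
    MuchnikEquivalent C D := by
  refine ⟨fun Y hY => ?_, fun X hX => ?_⟩
  · obtain ⟨X, hX, e⟩ := h.2 Y hY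
    exact ⟨X, hX, e.2⟩
  · obtain ⟨Y, hY, e⟩ := h.1 X hX
    exact ⟨Y, hY, e.2⟩

/-! ### Stagewise refutation of membership in a `Π⁰₁` class -/

/-- `B τ s` says that by stage `s` the string `τ` is seen to have no extension in `C`. -/
structure Refutes (B : List Bool → ℕ → Prop) (C : Set Seq) : Prop where
  primrec : PrimrecRel B
  mono : ∀ {σ τ : List Bool} {s t : ℕ}, σ <+: τ → s ≤ t → B σ s → B τ t
  take : ∀ {τ : List Bool} {s : ℕ}, B τ s → B (τ.take s) s
  mem_iff : ∀ X : Seq, X ∈ C ↔ ∀ n, ¬ B (restrict X n) n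

/-- Halting within `s` steps is primitive recursive and monotone in `s`. -/
theorem _root_.REPred.exists_primrec {α : Type*} [Primcodable α] {p : α → Prop} (h : REPred p) :
    ∃ E : α → ℕ → Prop, PrimrecRel E ∧ (∀ a s t, s ≤ t → E a s → E a t) ∧
      ∀ a, p a ↔ ∃ s, E a s := by
  obtain ⟨c, hc⟩ := Code.exists_code.1 h
  refine ⟨fun a s => (Code.evaln s c (encode a)).isSome = true, ?_, ?_, ?_⟩
  · exact Primrec.eq.comp (Primrec.option_isSome.comp (Code.primrec_evaln.comp (Primrec.pair
      (Primrec.pair Primrec.snd (Primrec.const c)) (Primrec.encode.comp Primrec.fst))))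
      (Primrec.const true)
  · intro a s t hst ha
    obtain ⟨x, hx⟩ := Option.isSome_iff_exists.1 ha
    exact Option.isSome_iff_exists.2 ⟨x, Code.evaln_mono hst hx⟩
  · intro a
    have h1 : (Code.eval c (encode a)).Dom ↔ p a := by
      rw [hc]
      simp [Part.assert]
    rw [← h1, Part.dom_iff_mem]
    simp only [Code.evaln_complete, Option.isSome_iff_exists, Option.mem_def]
    exact exists_comm

theorem IsPi01.exists_refutes {C : Set Seq} (h : IsPi01 C) : ∃ B, Refutes B C := by
  obtain ⟨S, hS, rfl⟩ := h
  obtain ⟨E, hE, hmono, hex⟩ := hS.exists_primrec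
  refine ⟨fun τ s => ∃ k < s + 1, E (τ.take k) s ∧ (τ.take k).length ≤ s, ⟨?_, ?_, ?_, ?_⟩⟩
  · refine PrimrecRel.exists_lt_bound (α := List Bool × ℕ)
      (R := fun k p => E (p.1.take k) p.2 ∧ (p.1.take k).length ≤ p.2)
      (PrimrecPred.and (hE.comp ?_ ?_) (Primrec.nat_le.comp (Primrec.list_length.comp ?_) ?_))
      (Primrec.succ.comp Primrec.snd)
    · exact Primrec.list_take.comp Primrec.fst (Primrec.fst.comp Primrec.snd)
    · exact Primrec.snd.comp Primrec.snd
    · exact Primrec.list_take.comp Primrec.fst (Primrec.fst.comp Primrec.snd)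
    · exact Primrec.snd.comp Primrec.snd
  · rintro σ τ s t ⟨υ, rfl⟩ hst ⟨k, hk, hE, hl⟩
    -- The refuting prefix may be all of `σ`; cutting at `k` alone could then reach into the
    -- extension.
    refine ⟨min k σ.length, by omega, ?_, ?_⟩
    · rw [List.take_append_of_le_length (by omega), ← List.take_eq_take_min]
      exact hmono _ _ _ hst hE
    · rw [List.take_append_of_le_length (by omega), ← List.take_eq_take_min]
      omega
  · rintro τ s ⟨k, hk, h⟩
    refine ⟨k, hk, ?_⟩
    rwa [List.take_take, min_eq_left (by omega)]
  · intro X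
    simp only [Set.mem_compl_iff, Set.mem_iUnion, not_exists]
    constructor
    · rintro h n k ⟨hk, hE, -⟩
      rw [take_restrict X (by omega)] at hE
      exact h _ ((hex _).2 ⟨n, hE⟩) (mem_cylinder_restrict X k)
    · intro h σ hσ hX
      obtain ⟨s, hs⟩ := (hex σ).1 hσ
      refine h (max s σ.length) σ.length ⟨by omega, ?_, ?_⟩
      · rw [take_restrict X (by omega), mem_cylinder.1 hX]
        exact hmono _ _ _ (le_max_left _ _) hs
      · rw [take_restrict X (by omega), length_restrict]
        omega

/-- The first string of length `s` that is not refuted by stage `s`. -/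
def survivor (B : List Bool → ℕ → Prop) (s : ℕ) : List Bool :=
  open Classical in ((allStrings s).filter fun τ => ¬ B τ s).headI

/-! ### Adjoining translates by surviving strings -/

section Survivor

variable {B : List Bool → ℕ → Prop} {C : Set Seq} (hB : Refutes B C)
include hB

theorem Refutes.primrec_survivor : Primrec (survivor B) := by
  classical
  have h : PrimrecRel fun τ s => ¬ B τ s := hB.primrec.not
  exact Primrec.list_headI.comp (h.listFilter.comp primrec_allStrings Primrec.id)

theorem Refutes.survivor_spec (hC : C.Nonempty) (s : ℕ) :
    (survivor B s).length = s ∧ ¬ B (survivor B s) s := by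
  classical
  obtain ⟨X, hX⟩ := hC
  have h0 : restrict X s ∈ (allStrings s).filter fun τ => ¬ B τ s := by
    simp [mem_allStrings, (hB.mem_iff X).1 hX s]
  have h1 : survivor B s ∈ (allStrings s).filter fun τ => ¬ B τ s := by
    unfold survivor
    generalize (allStrings s).filter (fun τ => ¬ B τ s) = l at h0
    cases l with
    | nil => simp at h0
    | cons a l => simp
  simpa [mem_allStrings] using h1

/-- The class `C` together with the translates of `C` by the surviving strings of the stages
in `A`. -/
def withTranslates (B : List Bool → ℕ → Prop) (A : ℕ → Prop) (C : Set Seq) : Set Seq :=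
  C ∪ {Y | ∃ s, A s ∧ ∃ X ∈ C, Y = concat (survivor B s) X}

/-- If `Y` is refuted for `C` at stage `s`, no survivor of a stage `r ≥ s` is a prefix of `Y`. Hence
excluding the translates of the stages below `s` excludes all of them, and this is visible on a
finite prefix of `Y`. -/
theorem Refutes.isPi01_withTranslates (hC : C.Nonempty) {A : ℕ → Prop} (hA : PrimrecPred A) :
    IsPi01 (withTranslates B A C) := by
  have hlen (s) := (hB.survivor_spec hC s).1
  refine ⟨{η | ∃ s < η.length + 1, B η s ∧ ∀ s' < s, ¬ A s' ∨ ¬ survivor B s' <+: η ∨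
    B (η.drop s') η.length}, ?_, ?_⟩
  · refine (PrimrecPred.computablePred ?_).to_re
    refine PrimrecRel.exists_lt_bound (R := fun s η => B η s ∧ ∀ s' < s, ¬ A s' ∨
      ¬ survivor B s' <+: η ∨ B (η.drop s') η.length) (PrimrecPred.and ?_ ?_)
      (Primrec.succ.comp Primrec.list_length)
    · exact hB.primrec.comp Primrec.snd Primrec.fst
    · refine PrimrecRel.forall_lt_bound (α := ℕ × List Bool) (R := fun s' p => ¬ A s' ∨
        ¬ survivor B s' <+: p.2 ∨ B (p.2.drop s') p.2.length) ?_ Primrec.fst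
      have h1 : Primrec fun p : ℕ × ℕ × List Bool => p.2.2 := Primrec.snd.comp Primrec.snd
      refine PrimrecPred.or (hA.comp Primrec.fst).not (PrimrecPred.or (PrimrecPred.not
        (primrecRel_prefix.comp (hB.primrec_survivor.comp Primrec.fst) h1)) ?_)
      exact hB.primrec.comp (Primrec.list_drop.comp Primrec.fst h1) (Primrec.list_length.comp h1)
  · ext Y
    simp only [Set.mem_compl_iff, Set.mem_iUnion, not_exists]
    constructor
    · rintro hY η ⟨s, hs, hη, hs'⟩ hYη
      rcases hY with hY | ⟨r, hr, X, hX, rfl⟩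
      · refine (hB.mem_iff Y).1 hY η.length (hB.mono ?_ (show s ≤ η.length by omega) hη)
        rw [mem_cylinder.1 hYη]
      rcases Nat.lt_or_ge r s with hrs | hrs
      · rcases hs' r hrs with h | h | h
        · exact h hr
        · refine h ?_
          rw [← mem_cylinder.1 hYη, prefix_restrict_iff (by rw [hlen]; omega)]
          exact concat_mem_cylinder _ _
        · refine (hB.mem_iff X).1 hX η.length (hB.mono ?_ le_rfl h)
          have e : η = survivor B r ++ restrict X (η.length - r) := by
            rw [← restrict_concat, hlen, show r + (η.length - r) = η.length by omega]
            exact (mem_cylinder.1 hYη).symm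
          have e2 : η.drop r = restrict X (η.length - r) := by
            conv_lhs => rw [e]
            exact List.drop_left' (hlen r)
          rw [e2]
          exact restrict_prefix X (Nat.sub_le _ _)
      -- The refutation at stage `s` reads only the first `s ≤ r` bits, which `Y` shares with the
      -- survivor of stage `r`, so that survivor would be refuted.
      · refine (hB.survivor_spec hC r).2 (hB.mono ?_ hrs (hB.take hη))
        have h1 : concat (survivor B r) X ∈ cylinder (η.take s) :=
          cylinder_anti (List.take_prefix _ _) hYη
        have h2 := mem_cylinder.1 (concat_mem_cylinder (survivor B r) X)
        rw [hlen] at h2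
        rw [← h2]
        exact (prefix_restrict_iff (by simp; omega)).2 h1
    · intro h
      by_contra hY
      simp only [withTranslates, Set.mem_union, Set.mem_ofPred_eq, not_or, not_exists, not_and] at hY
      obtain ⟨hYC, hYt⟩ := hY
      rw [hB.mem_iff] at hYC
      push Not at hYC
      obtain ⟨n, hn⟩ := hYC
      -- Each translate is excluded by all long enough prefixes of `Y`, so one length serves for the
      -- finitely many stages below `n`.
      have key (s' : ℕ) : ∀ᶠ R in atTop, ¬ A s' ∨ ¬ survivor B s' <+: restrict Y R ∨
          B ((restrict Y R).drop s') R := by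
        by_cases hA' : A s'
        swap
        · exact Eventually.of_forall fun _ => Or.inl hA'
        by_cases hp : Y ∈ cylinder (survivor B s')
        swap
        · filter_upwards [eventually_ge_atTop s'] with R hR
          right; left
          rwa [prefix_restrict_iff (by rwa [hlen])]
        have hmem : (fun i => Y (s' + i)) ∉ C := by
          intro hC'
          refine hYt s' hA' _ hC' ?_
          rw [← mem_cylinder.1 hp, hlen, concat_restrict]
        rw [hB.mem_iff] at hmem
        push Not at hmem
        obtain ⟨m, hm⟩ := hmem
        filter_upwards [eventually_ge_atTop (s' + m)] with R hR
        right; right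
        refine hB.mono ?_ (show m ≤ R by omega) hm
        rw [show R = s' + (R - s') by omega, restrict_add, List.drop_left' (length_restrict _ _)]
        exact restrict_prefix _ (by omega)
      obtain ⟨R, hR⟩ := (((Filter.eventually_all_finset (Finset.range n)).2
        fun s' _ => key s').and (eventually_ge_atTop n)).exists
      refine h (restrict Y R) ⟨n, by simp; omega, ?_, fun s' hs' => ?_⟩ (mem_cylinder_restrict Y R)
      · exact hB.mono (restrict_prefix Y hR.2) le_rfl hn
      · rw [length_restrict]
        exact hR.1 s' (Finset.mem_range.2 hs')

end Survivor

/-! ### Computably many strings of large measure -/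

/-- `s` is the first stage from `k` on that satisfies `R k`. -/
def FirstStage (R : ℕ → ℕ → Prop) (k s : ℕ) : Prop :=
  k ≤ s ∧ R k s ∧ ∀ r < s, ¬ (k ≤ r ∧ R k r)

theorem primrecRel_firstStage {R : ℕ → ℕ → Prop} (hR : PrimrecRel R) :
    PrimrecRel (FirstStage R) := by
  have h : PrimrecPred fun p : ℕ × ℕ => p.1 ≤ p.2 ∧ R p.1 p.2 :=
    PrimrecPred.and (Primrec.nat_le.comp Primrec.fst Primrec.snd)
      (hR.comp Primrec.fst Primrec.snd)
  refine PrimrecPred.of_eq (h.and (PrimrecRel.forall_lt_bound (α := ℕ × ℕ)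
    (R := fun r p => ¬ (p.1 ≤ r ∧ R p.1 r)) (PrimrecPred.not ?_) Primrec.snd))
    fun p => and_assoc
  exact h.comp (Primrec.pair (Primrec.fst.comp Primrec.snd) Primrec.fst)

theorem FirstStage.unique {R : ℕ → ℕ → Prop} {k s s' : ℕ} (h : FirstStage R k s)
    (h' : FirstStage R k s') : s = s' := by
  rcases lt_trichotomy s s' with hs | hs | hs
  · exact absurd ⟨h.1, h.2.1⟩ (h'.2.2 s hs)
  · exact hs
  · exact absurd ⟨h'.1, h'.2.1⟩ (h.2.2 s' hs)

theorem exists_firstStage {R : ℕ → ℕ → Prop} {k s : ℕ} (hk : k ≤ s) (h : R k s) :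
    ∃ s', FirstStage R k s' := by
  classical
  have hex : ∃ s, k ≤ s ∧ R k s := ⟨s, hk, h⟩
  exact ⟨Nat.find hex, (Nat.find_spec hex).1, (Nat.find_spec hex).2,
    fun r hr => Nat.find_min hex hr⟩

open Classical in
/-- The approximation to the semi-measure that puts weight `2 ^ -(k + 1)` on the string `t s`
for the first stage `s` of `k`. -/
def stageApprox (R : ℕ → ℕ → Prop) (t : ℕ → List Bool) (η : List Bool) (s : ℕ) : ℕ :=
  ((List.range s).map fun k =>
    if ∃ r < s, FirstStage R k r ∧ η <+: t r then 2 ^ s / 2 ^ (k + 1) else 0).sum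

open Classical in
theorem stageApprox_eq (R : ℕ → ℕ → Prop) (t : ℕ → List Bool) (η : List Bool) (s : ℕ) :
    stageApprox R t η s = ∑ k ∈ Finset.range s,
      if ∃ r < s, FirstStage R k r ∧ η <+: t r then 2 ^ s / 2 ^ (k + 1) else 0 := rfl

theorem isApprox_stageApprox {R : ℕ → ℕ → Prop} (hR : PrimrecRel R) {t : ℕ → List Bool}
    (ht : Primrec t) : IsApprox (stageApprox R t) where
  primrec := by
    classical
    refine primrec_sum_map (f := fun p : List Bool × ℕ => List.range p.2)
      (g := fun p k => if ∃ r < p.2, FirstStage R k r ∧ p.1 <+: t r then 2 ^ p.2 / 2 ^ (k + 1)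
        else 0) (Primrec.list_range.comp Primrec.snd) (Primrec.ite ?_ ?_ (Primrec.const 0))
    · refine PrimrecRel.exists_lt_bound (α := (List Bool × ℕ) × ℕ)
        (R := fun r q => FirstStage R q.2 r ∧ q.1.1 <+: t r) (PrimrecPred.and ?_ ?_)
        (Primrec.snd.comp Primrec.fst)
      · exact (primrecRel_firstStage hR).comp (Primrec.snd.comp Primrec.snd) Primrec.fst
      · exact primrecRel_prefix.comp (Primrec.fst.comp (Primrec.fst.comp Primrec.snd))
          (ht.comp Primrec.fst)
    · exact Primrec.nat_div.comp (primrec_two_pow (Primrec.snd.comp Primrec.fst))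
        (primrec_two_pow (Primrec.succ.comp Primrec.snd))
  double σ s := by
    classical
    rw [stageApprox_eq, stageApprox_eq, Finset.mul_sum, Finset.sum_range_succ]
    refine le_trans (Finset.sum_le_sum fun k _ => ?_) (Nat.le_add_right _ _)
    by_cases h : ∃ r < s, FirstStage R k r ∧ σ <+: t r
    · obtain ⟨r, hr, h'⟩ := h
      rw [if_pos ⟨r, hr, h'⟩, if_pos ⟨r, hr.trans (Nat.lt_succ_self s), h'⟩, pow_succ 2 s, mul_comm _ 2]
      exact Nat.mul_div_le_mul_div_assoc _ _ _
    · rw [if_neg h]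
      exact Nat.zero_le _
  superadditive σ s := by
    classical
    rw [stageApprox_eq, stageApprox_eq, stageApprox_eq, ← Finset.sum_add_distrib]
    refine Finset.sum_le_sum fun k _ => ?_
    have hp (b : Bool) : (∃ r < s, FirstStage R k r ∧ σ ++ [b] <+: t r) →
        ∃ r < s, FirstStage R k r ∧ σ <+: t r := fun ⟨r, hr, h1, h2⟩ =>
      ⟨r, hr, h1, (List.prefix_append σ [b]).trans h2⟩
    by_cases h0 : ∃ r < s, FirstStage R k r ∧ σ ++ [false] <+: t r
    -- The first stage of `k` is unique, so `k` supports a single string, which cannot extend both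
    -- children.
    · have h1 : ¬ ∃ r < s, FirstStage R k r ∧ σ ++ [true] <+: t r := by
        obtain ⟨r, -, hr, hpr⟩ := h0
        rintro ⟨r', -, hr', hpr'⟩
        obtain rfl := hr.unique hr'
        have := List.prefix_of_prefix_length_le hpr hpr' (by simp)
        simp at this
      rw [if_pos h0, if_neg h1, if_pos (hp _ h0), add_zero]
    · rw [if_neg h0, zero_add]
      by_cases h1 : ∃ r < s, FirstStage R k r ∧ σ ++ [true] <+: t r
      · rw [if_pos h1, if_pos (hp _ h1)]
      · rw [if_neg h1]
        exact Nat.zero_le _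
  root s := by
    classical
    rw [stageApprox_eq]
    refine (Finset.sum_le_sum fun k _ => ?_).trans
      ((Nat.le_add_right _ _).trans (sum_two_pow_div_le s s le_rfl))
    split_ifs
    · exact le_rfl
    · exact Nat.zero_le _

/-- One constant serves all `k`, by domination of the semi-measure built from `stageApprox`. A later
`k` can therefore be chosen to exceed it. -/
theorem IsUniversal.exists_le_of_firstStage {M : List Bool → ℝ} (hM : IsUniversal M)
    {R : ℕ → ℕ → Prop} (hR : PrimrecRel R) {t : ℕ → List Bool} (ht : Primrec t) :
    ∃ c : ℕ, ∀ k s, FirstStage R k s → (2 : ℝ)⁻¹ ^ (k + 1) ≤ c * M (t s) := by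
  classical
  obtain ⟨ρ, hρ, hρlsc, hle⟩ := (isApprox_stageApprox hR ht).exists_semimeasure
  obtain ⟨c, hc⟩ := hM.2.2 ρ hρ hρlsc
  refine ⟨c, fun k s h => le_trans ?_ ((hle (t s) (s + 1)).trans (hc _))⟩
  -- The clause `k ≤ s` of `FirstStage` ensures that the weight of `k` is already counted at stage
  -- `s + 1`, and without rounding.
  have hk : k + 1 ≤ s + 1 := Nat.succ_le_succ h.1
  have h1 : 2 ^ (s + 1) / 2 ^ (k + 1) ≤ stageApprox R t (t s) (s + 1) := by
    rw [stageApprox_eq]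
    refine le_trans ?_ (Finset.single_le_sum (fun _ _ => Nat.zero_le _)
      (Finset.mem_range.2 (show k < s + 1 from hk)))
    rw [if_pos ⟨s, Nat.lt_succ_self s, h, List.prefix_rfl⟩]
  rw [Nat.pow_div hk (by norm_num)] at h1
  have h2 : (2 : ℝ) ^ (s + 1 - (k + 1)) ≤ stageApprox R t (t s) (s + 1) := by exact_mod_cast h1
  rw [le_div_iff₀ (by positivity)]
  refine le_trans (le_of_eq ?_) h2
  rw [inv_pow, inv_mul_eq_div, div_eq_iff (by positivity), ← pow_add, Nat.sub_add_cancel hk]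

theorem le_levelSum {M : List Bool → ℝ} (hM : IsSemimeasure M) {T : Set (List Bool)}
    {σ : List Bool} (hσ : σ ∈ T) : M σ ≤ levelSum M T σ.length := by
  classical
  rw [levelSum_eq]
  refine le_trans (le_of_eq (if_pos hσ).symm) (Finset.single_le_sum
    (f := fun τ => if τ ∈ T then M τ else 0) (fun τ _ => ?_) (mem_strings.2 rfl))
  split_ifs
  exacts [hM.nonneg τ, le_rfl]

/-! ### Every non-empty class has a non-deep class of translates -/

/-- The `k.unpair.1`-th code has, within `s` steps, a value of at least `2 * k + 2` at an argument
of at most `s`. -/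
def LargeValue (k s : ℕ) : Prop :=
  ∃ n < s + 1, 2 * k + 2 ≤ (Code.evaln s (Denumerable.ofNat Code k.unpair.1) n).getD 0

theorem primrecRel_largeValue : PrimrecRel LargeValue := by
  refine PrimrecRel.exists_lt_bound (α := ℕ × ℕ) (R := fun n p => 2 * p.1 + 2 ≤
    (Code.evaln p.2 (Denumerable.ofNat Code p.1.unpair.1) n).getD 0)
    (Primrec.nat_le.comp ?_ (Primrec.option_getD.comp ?_ (Primrec.const 0)))
    (Primrec.succ.comp Primrec.snd)
  · exact Primrec.succ.comp (Primrec.succ.comp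
      (Primrec.nat_mul.comp (Primrec.const 2) (Primrec.fst.comp Primrec.snd)))
  · refine Code.primrec_evaln.comp (Primrec.pair (Primrec.pair ?_ ?_) Primrec.fst)
    · exact Primrec.snd.comp Primrec.snd
    · exact (Primrec.ofNat Code).comp (Primrec.fst.comp (Primrec.unpair.comp
        (Primrec.fst.comp Primrec.snd)))

/-- The class `C` together with its translates by the survivors of the stages at which some
code is seen to have a large value. -/
def nonDeepExtension (B : List Bool → ℕ → Prop) (C : Set Seq) : Set Seq :=
  withTranslates B (fun s => ∃ k < s + 1, FirstStage LargeValue k s) C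

theorem Refutes.isPi01_nonDeepExtension {B : List Bool → ℕ → Prop} {C : Set Seq}
    (hB : Refutes B C) (hC : C.Nonempty) : IsPi01 (nonDeepExtension B C) := by
  refine hB.isPi01_withTranslates hC (PrimrecRel.exists_lt_bound (α := ℕ)
    (R := fun k s => FirstStage LargeValue k s) ?_ Primrec.succ)
  exact primrecRel_firstStage primrecRel_largeValue

theorem Refutes.not_deep_nonDeepExtension {B : List Bool → ℕ → Prop} {C : Set Seq}
    (hB : Refutes B C) (hC : C.Nonempty) {M : List Bool → ℝ} (hM : IsUniversal M) :
    ¬ Deep M (nonDeepExtension B C) := by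
  rintro ⟨h, ⟨hcomp, -, hunb⟩, hdeep⟩
  obtain ⟨c, hc⟩ := hM.exists_le_of_firstStage primrecRel_largeValue hB.primrec_survivor
  obtain ⟨code, hcode⟩ := Code.exists_code.1 (Partrec.nat_iff.1 hcomp)
  obtain ⟨e, rfl⟩ : ∃ e, code = Denumerable.ofNat Code e := ⟨encode code, by simp⟩
  have heval (n : ℕ) : h n ∈ Code.eval (Denumerable.ofNat Code e) n := by
    rw [hcode]
    exact Part.mem_some _
  -- The index `k = ⟨e, c⟩` names the program for `h` and also dominates the constant `c`.
  have hk : (Nat.pair e c).unpair.1 = e := by simp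
  have hck : c ≤ Nat.pair e c := Nat.right_le_pair e c
  generalize Nat.pair e c = k at hk hck
  obtain ⟨n, hn⟩ := hunb (2 * k + 2)
  obtain ⟨r, hr⟩ := Code.evaln_complete.1 (heval n)
  have hlarge : LargeValue k (max (max r n) k) := by
    refine ⟨n, by omega, ?_⟩
    rw [hk, Option.mem_def.1 (Code.evaln_mono (show r ≤ max (max r n) k by omega) hr)]
    exact hn
  obtain ⟨s, hs⟩ := exists_firstStage (le_max_right _ _) hlarge
  obtain ⟨m, hm, hval⟩ := hs.2.1
  have hhm : 2 * k + 2 ≤ h m := by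
    rw [hk] at hval
    cases hv : Code.evaln s (Denumerable.ofNat Code e) m with
    | none => simp [hv] at hval
    | some v =>
      obtain rfl := Part.mem_unique (Code.evaln_sound hv) (heval m)
      simpa [hv] using hval
  have hlen := (hB.survivor_spec hC s).1
  have hmem : (survivor B s).take m ∈ canonicalTree (nonDeepExtension B C) := by
    obtain ⟨X, hX⟩ := hC
    exact ⟨concat (survivor B s) X,
      cylinder_anti (List.take_prefix _ _) (concat_mem_cylinder _ _),
      Or.inr ⟨s, ⟨k, Nat.lt_succ_of_le hs.1, hs⟩, X, hX, rfl⟩⟩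
  have h1 := le_levelSum hM.1 hmem
  rw [List.length_take, hlen, min_eq_left (by omega)] at h1
  have h2 : M (survivor B s) ≤ (2 : ℝ)⁻¹ ^ (2 * k + 2) :=
    (hM.1.anti (List.take_prefix m _)).trans (h1.trans ((hdeep m).trans
      (pow_le_pow_of_le_one (by norm_num) (by norm_num) hhm)))
  have h3 : (2 : ℝ)⁻¹ ^ (k + 1) ≤ c * (2 : ℝ)⁻¹ ^ (2 * k + 2) :=
    (hc k s hs).trans (mul_le_mul_of_nonneg_left h2 (Nat.cast_nonneg c))
  -- The exponent `2 * k + 2` is twice `k + 1`, so one factor cancels and `2 ^ (k + 1) ≤ c ≤ k` is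
  -- left.
  have h4 : (2 : ℝ) ^ (k + 1) ≤ c := by
    rw [show 2 * k + 2 = (k + 1) + (k + 1) by ring, pow_add _ (k + 1) (k + 1), ← mul_assoc, inv_pow] at h3
    have h5 : (0 : ℝ) < (2 ^ (k + 1))⁻¹ := by positivity
    have h6 := le_of_mul_le_mul_right ((one_mul _).trans_le h3) h5
    rwa [← div_eq_mul_inv, le_div_iff₀ (by positivity), one_mul] at h6
  have h5 : 2 ^ (k + 1) ≤ c := by exact_mod_cast h4
  have h6 : k + 1 < 2 ^ (k + 1) := Nat.lt_two_pow_self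
  omega

theorem exists_nonDeep_extension {M : List Bool → ℝ} (hM : IsUniversal M) {C : Set Seq}
    (h : IsPi01 C) (hC : C.Nonempty) : ∃ D : Set Seq, IsPi01 D ∧ C ⊆ D ∧
      (∀ Y ∈ D, ∃ σ : List Bool, ∃ X ∈ C, Y = concat σ X) ∧ ¬ Deep M D := by
  obtain ⟨B, hB⟩ := h.exists_refutes
  refine ⟨nonDeepExtension B C, hB.isPi01_nonDeepExtension hC, Set.subset_union_left, ?_,
    hB.not_deep_nonDeepExtension hC hM⟩
  rintro Y (hY | ⟨s, -, X, hX, rfl⟩)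
  · exact ⟨[], Y, hY, (concat_nil Y).symm⟩
  · exact ⟨_, X, hX, rfl⟩

/-! ### A deep class -/

open Classical in
/-- The `f`-weight of the strings of length `2 ^ (j + 2)` whose second half extends `L`. -/
def blockSum {A : Type*} [AddCommMonoid A] (f : List Bool → A) (j : ℕ) (L : List Bool) : A :=
  ∑ τ ∈ strings (2 ^ (j + 2)), if L <+: τ.drop (2 ^ (j + 1)) then f τ else 0

theorem prefix_snoc_iff {L υ : List Bool} {b : Bool} (h : L.length < υ.length) :
    L ++ [b] <+: υ ↔ L <+: υ ∧ υ[L.length] = b := by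
  rw [List.prefix_iff_eq_take, List.prefix_iff_eq_take, List.length_append, List.length_singleton,
    List.take_add_one, List.getElem?_eq_getElem h]
  constructor
  · intro e
    have := List.append_inj' e (by simp)
    exact ⟨this.1, by simpa using this.2.symm⟩
  · rintro ⟨h1, h2⟩
    rw [← h1, h2]
    rfl

theorem length_drop_of_mem_strings {j : ℕ} {τ : List Bool} (h : τ ∈ strings (2 ^ (j + 2))) :
    (τ.drop (2 ^ (j + 1))).length = 2 ^ (j + 1) := by
  rw [List.length_drop, mem_strings.1 h, pow_succ 2 (j + 1)]
  omega

theorem blockSum_split {A : Type*} [AddCommMonoid A] (f : List Bool → A) (j : ℕ) {L : List Bool}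
    (hL : L.length < 2 ^ (j + 1)) (b : Bool) :
    blockSum f j (L ++ [b]) + blockSum f j (L ++ [!b]) = blockSum f j L := by
  classical
  unfold blockSum
  rw [← Finset.sum_add_distrib]
  refine Finset.sum_congr rfl fun τ hτ => ?_
  have hlt : L.length < (τ.drop (2 ^ (j + 1))).length := by
    rwa [length_drop_of_mem_strings hτ]
  simp only [prefix_snoc_iff hlt]
  by_cases h : L <+: τ.drop (2 ^ (j + 1))
  · rcases Bool.eq_or_eq_not (τ.drop (2 ^ (j + 1)))[L.length] b with h' | h' <;> simp [h, h']
  · simp [h]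

theorem blockSum_nonneg {f : List Bool → ℝ} (hf : ∀ σ, 0 ≤ f σ) (j : ℕ) (L : List Bool) :
    0 ≤ blockSum f j L := by
  refine Finset.sum_nonneg fun τ _ => ?_
  split_ifs
  exacts [hf τ, le_rfl]

/-- The approximation at stage `s` to the weight `blockSum`, with denominator `2 ^ s`. -/
def codeBlockSum (c : Code) (s j : ℕ) (L : List Bool) : ℕ := blockSum (codeApprox c s) j L

/-- A bit `b` for which `L ++ [b]` has at most half of the weight of `L` at stage `s`. -/
def lightBit (c : Code) (j s : ℕ) (L : List Bool) : Bool :=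
  decide (codeBlockSum c s j (L ++ [true]) < codeBlockSum c s j (L ++ [false]))

/-- The constraint for the `j`-th block at stage `s`: as long as the approximation gives the
strings of length `2 ^ (j + 2)` that obey the constraint a weight of more than `2 ^ (-j)`,
append the bit whose negation has the larger weight. -/
def constraint (c : Code) (j s : ℕ) : List Bool :=
  Nat.rec [] (fun s L => if 2 ^ s < 2 ^ j * codeBlockSum c s j L then
    L ++ [lightBit c j s L] else L) s

theorem constraint_succ (c : Code) (j s : ℕ) : constraint c j (s + 1) =
    if 2 ^ s < 2 ^ j * codeBlockSum c s j (constraint c j s) then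
      constraint c j s ++ [lightBit c j s (constraint c j s)] else constraint c j s := rfl

theorem lightBit_spec (c : Code) (j s : ℕ) (L : List Bool) :
    codeBlockSum c s j (L ++ [lightBit c j s L]) ≤
      codeBlockSum c s j (L ++ [!lightBit c j s L]) := by
  unfold lightBit
  by_cases h : codeBlockSum c s j (L ++ [true]) < codeBlockSum c s j (L ++ [false])
  · rw [decide_eq_true h]
    exact h.le
  · rw [decide_eq_false h]
    exact not_lt.1 h

theorem primrec_codeBlockSum (c : Code) :
    Primrec fun p : (ℕ × ℕ) × List Bool => codeBlockSum c p.1.1 p.1.2 p.2 := by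
  classical
  refine (primrec_sum_map (f := fun p : (ℕ × ℕ) × List Bool => allStrings (2 ^ (p.1.2 + 2)))
    (g := fun p τ => if p.2 <+: τ.drop (2 ^ (p.1.2 + 1)) then codeApprox c p.1.1 τ else 0)
    (primrec_allStrings.comp (primrec_two_pow (Primrec.succ.comp (Primrec.succ.comp
      (Primrec.snd.comp Primrec.fst))))) (Primrec.ite ?_ ?_ (Primrec.const 0))).of_eq fun p =>
    (sum_strings_eq_list _ _).symm
  · exact primrecRel_prefix.comp (Primrec.snd.comp Primrec.fst) (Primrec.list_drop.comp
      (primrec_two_pow (Primrec.succ.comp (Primrec.snd.comp (Primrec.fst.comp Primrec.fst))))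
      Primrec.snd)
  · exact primrec_codeApprox.comp (Primrec.pair (Primrec.pair (Primrec.const c)
      (Primrec.fst.comp (Primrec.fst.comp Primrec.fst))) Primrec.snd)

theorem primrec_constraint (c : Code) : Primrec₂ (constraint c) := by
  have hb {f : (ℕ × ℕ) × ℕ × List Bool → List Bool} (hf : Primrec f) :
      Primrec fun p : (ℕ × ℕ) × ℕ × List Bool => codeBlockSum c p.2.1 p.1.1 (f p) :=
    Primrec.comp (g := fun p : (ℕ × ℕ) × ℕ × List Bool => ((p.2.1, p.1.1), f p))
      (primrec_codeBlockSum c) (Primrec.pair (Primrec.pair (Primrec.fst.comp Primrec.snd)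
      (Primrec.fst.comp Primrec.fst)) hf)
  have hL : Primrec fun p : (ℕ × ℕ) × ℕ × List Bool => p.2.2 := Primrec.snd.comp Primrec.snd
  have ha (b : Bool) := hb (Primrec.list_concat.comp hL (Primrec.const b))
  refine Primrec.nat_rec' (f := fun p : ℕ × ℕ => p.2) (g := fun _ => [])
    (h := fun (p : ℕ × ℕ) (q : ℕ × List Bool) =>
      if 2 ^ q.1 < 2 ^ p.1 * codeBlockSum c q.1 p.1 q.2 then
      q.2 ++ [decide (codeBlockSum c q.1 p.1 (q.2 ++ [true]) <
        codeBlockSum c q.1 p.1 (q.2 ++ [false]))] else q.2)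
    Primrec.snd (Primrec.const []) (Primrec.ite (Primrec.nat_lt.comp ?_
      (Primrec.nat_mul.comp ?_ (hb hL))) (Primrec.list_concat.comp hL
      (PrimrecPred.decide (Primrec.nat_lt.comp (ha true) (ha false)))) hL)
  · exact primrec_two_pow (Primrec.fst.comp Primrec.snd)
  · exact primrec_two_pow (Primrec.fst.comp Primrec.fst)

theorem constraint_prefix (c : Code) (j : ℕ) {s t : ℕ} (h : s ≤ t) :
    constraint c j s <+: constraint c j t := by
  induction h with
  | refl => exact List.prefix_rfl
  | step h ih =>
    refine ih.trans ?_
    rw [Nat.succ_eq_add_one, constraint_succ]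
    split_ifs
    · exact List.prefix_append _ _
    · exact List.prefix_rfl

/-! ### The weight removed by the constraints -/

section Constraint

variable {c : Code} {M : List Bool → ℝ} (hc : CodeFor c M)
include hc

theorem CodeFor.blockSum_le (j s : ℕ) (L : List Bool) :
    (codeBlockSum c s j L : ℝ) / 2 ^ s ≤ blockSum M j L := by
  unfold codeBlockSum blockSum
  push_cast
  rw [Finset.sum_div]
  refine Finset.sum_le_sum fun τ _ => ?_
  split_ifs
  · exact (hc τ).1 s
  · simp

theorem CodeFor.tendsto_blockSum (j : ℕ) (L : List Bool) :
    Tendsto (fun s => (codeBlockSum c s j L : ℝ) / 2 ^ s) atTop (𝓝 (blockSum M j L)) := by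
  unfold codeBlockSum blockSum
  push_cast
  simp only [Finset.sum_div]
  refine tendsto_finsetSum _ fun τ _ => ?_
  split_ifs
  · exact (hc τ).2
  · simp

/-- Every appended bit removes true weight at least `2 ^ -(j + 1)`, namely half of an approximate
weight above `2 ^ -j`. -/
theorem CodeFor.blockSum_constraint_le (hM : IsSemimeasure M) (j s : ℕ) :
    blockSum M j (constraint c j s) ≤ 1 - (constraint c j s).length * (2 : ℝ)⁻¹ ^ (j + 1) := by
  induction s with
  | zero =>
    have := hM.sum_strings_le (2 ^ (j + 2))
    simpa [constraint, blockSum] using this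
  | succ s ih =>
    rw [constraint_succ]
    generalize constraint c j s = L at ih
    split_ifs with h
    swap
    · exact ih
    generalize hb : lightBit c j s L = b
    have h1 : (2 : ℝ)⁻¹ ^ j < codeBlockSum c s j L / 2 ^ s := by
      have h' : (2 : ℝ) ^ s < 2 ^ j * codeBlockSum c s j L := by exact_mod_cast h
      rw [lt_div_iff₀ (by positivity), inv_pow, inv_mul_eq_div, div_lt_iff₀ (by positivity)]
      linarith
    have h2 := hc.blockSum_le j s L
    have h3 : (2 : ℝ)⁻¹ ^ j = 2 * 2⁻¹ ^ (j + 1) := by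
      rw [pow_succ]; ring
    have hpos : (0 : ℝ) < 2⁻¹ ^ (j + 1) := by positivity
    -- The remaining weight is positive, so the induction hypothesis leaves room in the block for
    -- one more bit.
    have hlen : L.length < 2 ^ (j + 1) := by
      have h4 : (L.length : ℝ) * 2⁻¹ ^ (j + 1) < 1 := by linarith
      rw [inv_pow, ← div_eq_mul_inv, div_lt_one (by positivity)] at h4
      exact_mod_cast h4
    have h4 := blockSum_split M j hlen b
    have h5 := blockSum_split (codeApprox c s) j hlen b
    change codeBlockSum c s j _ + codeBlockSum c s j _ = codeBlockSum c s j _ at h5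
    have h6 := lightBit_spec c j s L
    rw [hb] at h6
    have h7 : (codeBlockSum c s j L : ℝ) / 2 ^ s ≤
        2 * (codeBlockSum c s j (L ++ [!b]) / 2 ^ s) := by
      rw [← mul_div_assoc]
      gcongr
      exact_mod_cast (by omega : codeBlockSum c s j L ≤
        2 * codeBlockSum c s j (L ++ [!b]))
    -- The heavier half is chosen by its approximate weight, but that is a lower bound for the true
    -- weight discarded.
    have h8 := hc.blockSum_le j s (L ++ [!b])
    rw [List.length_append, List.length_singleton]
    push_cast
    linarith

theorem CodeFor.length_constraint_le (hM : IsSemimeasure M) (j s : ℕ) :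
    (constraint c j s).length ≤ 2 ^ (j + 1) := by
  have h1 := hc.blockSum_constraint_le hM j s
  have h2 := blockSum_nonneg hM.nonneg j (constraint c j s)
  have h3 : ((constraint c j s).length : ℝ) * 2⁻¹ ^ (j + 1) ≤ 1 := by linarith
  rw [inv_pow, ← div_eq_mul_inv, div_le_one (by positivity)] at h3
  exact_mod_cast h3

/-- The constraint has bounded length and only grows, so it stabilises. From then on every
approximate weight is at most `2 ^ -j`, and so is the limit. -/
theorem CodeFor.exists_constraint_light (hM : IsSemimeasure M) (j : ℕ) :
    ∃ s, blockSum M j (constraint c j s) ≤ (2 : ℝ)⁻¹ ^ j := by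
  have hfin : ∃ s, ∀ t, (constraint c j t).length ≤ (constraint c j s).length := by
    have hb : (Set.range fun s => (constraint c j s).length).Finite :=
      (Set.finite_Iic (2 ^ (j + 1))).subset (by
        rintro _ ⟨s, rfl⟩; exact hc.length_constraint_le hM j s)
    obtain ⟨_, ⟨s, rfl⟩, hs⟩ := hb.exists_maximal (Set.range_nonempty _)
    refine ⟨s, fun t => ?_⟩
    rcases le_total (constraint c j t).length (constraint c j s).length with h | h
    · exact h
    · exact hs ⟨t, rfl⟩ h
  obtain ⟨s, hs⟩ := hfin
  refine ⟨s, le_of_tendsto (hc.tendsto_blockSum j _) (eventually_atTop.2 ⟨s, fun t ht => ?_⟩)⟩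
  have e : constraint c j s = constraint c j t := (constraint_prefix c j ht).eq_of_length_le (hs t)
  have hlight : ¬ 2 ^ t < 2 ^ j * codeBlockSum c t j (constraint c j t) := by
    intro h
    have := hs (t + 1)
    rw [constraint_succ, if_pos h, e] at this
    simp at this
  rw [e]
  have h' : (2 : ℝ) ^ j * codeBlockSum c t j (constraint c j t) ≤ 2 ^ t := by
    exact_mod_cast not_lt.1 hlight
  rw [div_le_iff₀ (by positivity), inv_pow, inv_mul_eq_div, le_div_iff₀ (by positivity)]
  linarith

end Constraint

/-- The class of all sequences whose blocks of positions from `2 ^ (j + 1)` to `2 ^ (j + 2)` obey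
the constraints. -/
def constraintClass (c : Code) : Set Seq :=
  {X | ∀ j s, (fun i => X (2 ^ (j + 1) + i)) ∈ cylinder (constraint c j s)}

theorem CodeFor.prefix_drop_iff {c : Code} {M : List Bool → ℝ} (hc : CodeFor c M)
    (hM : IsSemimeasure M) (X : Seq) (j s : ℕ) {n : ℕ} (hn : 2 ^ (j + 2) ≤ n) :
    constraint c j s <+: (restrict X n).drop (2 ^ (j + 1)) ↔
      (fun i => X (2 ^ (j + 1) + i)) ∈ cylinder (constraint c j s) := by
  have hlen := hc.length_constraint_le hM j s
  rw [pow_succ 2 (j + 1)] at hn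
  rw [show n = 2 ^ (j + 1) + (n - 2 ^ (j + 1)) by omega, restrict_add,
    List.drop_left' (length_restrict _ _), prefix_restrict_iff (by omega)]

theorem CodeFor.isPi01_constraintClass {c : Code} {M : List Bool → ℝ} (hc : CodeFor c M)
    (hM : IsSemimeasure M) : IsPi01 (constraintClass c) := by
  -- The block must lie wholly inside `η`: otherwise a constraint could fail to be a prefix merely
  -- because `η` is too short.
  refine ⟨{η | ∃ j < η.length, ∃ s < η.length + 1, 2 ^ (j + 2) ≤ η.length ∧
    ¬ constraint c j s <+: η.drop (2 ^ (j + 1))}, ?_, ?_⟩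
  · refine (PrimrecPred.computablePred ?_).to_re
    refine PrimrecRel.exists_lt_bound (α := List Bool) (R := fun j η => ∃ s < η.length + 1,
      2 ^ (j + 2) ≤ η.length ∧ ¬ constraint c j s <+: η.drop (2 ^ (j + 1))) ?_ Primrec.list_length
    refine PrimrecRel.exists_lt_bound (α := ℕ × List Bool) (R := fun s p =>
      2 ^ (p.1 + 2) ≤ p.2.length ∧ ¬ constraint c p.1 s <+: p.2.drop (2 ^ (p.1 + 1)))
      (PrimrecPred.and ?_ (PrimrecPred.not ?_))
      (Primrec.succ.comp (Primrec.list_length.comp Primrec.snd))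
    · exact Primrec.nat_le.comp (primrec_two_pow (Primrec.succ.comp (Primrec.succ.comp
        (Primrec.fst.comp Primrec.snd)))) (Primrec.list_length.comp (Primrec.snd.comp Primrec.snd))
    · exact primrecRel_prefix.comp ((primrec_constraint c).comp (Primrec.fst.comp Primrec.snd)
        Primrec.fst) (Primrec.list_drop.comp (primrec_two_pow (Primrec.succ.comp
        (Primrec.fst.comp Primrec.snd))) (Primrec.snd.comp Primrec.snd))
  · ext X
    simp only [Set.mem_compl_iff, Set.mem_iUnion, not_exists]
    constructor
    · rintro h η ⟨j, -, s, -, hj, hη⟩ hX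
      rw [← mem_cylinder.1 hX, hc.prefix_drop_iff hM X j s hj] at hη
      exact hη (h j s)
    · intro h j s
      by_contra hX
      rw [← hc.prefix_drop_iff hM X j s (le_max_left _ s)] at hX
      refine h _ ⟨j, ?_, s, ?_, ?_, hX⟩ (mem_cylinder_restrict _ _) <;> rw [length_restrict]
      · have : j + 2 < 2 ^ (j + 2) := Nat.lt_two_pow_self
        omega
      · omega
      · omega

theorem CodeFor.constraintClass_nonempty {c : Code} {M : List Bool → ℝ} (hc : CodeFor c M)
    (hM : IsSemimeasure M) : (constraintClass c).Nonempty := by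
  classical
  -- Position `n ≥ 2` lies in block `Nat.log 2 n - 1` at offset `n - 2 ^ Nat.log 2 n`. It gets the
  -- bit that some stage of the constraint prescribes there, or `false` if none does. The stages
  -- agree because they extend one another.
  refine ⟨fun n => decide (∃ s,
    (constraint c (Nat.log 2 n - 1) s)[n - 2 ^ Nat.log 2 n]? = some true), fun j s => ?_⟩
  rw [mem_cylinder]
  refine List.ext_getElem (by simp) fun i _ hi => ?_
  have hlt : i < 2 ^ (j + 1) := hi.trans_le (hc.length_constraint_le hM j s)
  have hlog : Nat.log 2 (2 ^ (j + 1) + i) = j + 1 :=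
    (Nat.log_eq_iff (by simp)).2 ⟨by omega, by rw [pow_succ 2 (j + 1)]; omega⟩
  simp only [restrict, List.getElem_ofFn, hlog, Nat.add_sub_cancel, Nat.add_sub_cancel_left]
  have hs : (constraint c j s)[i]? = some (constraint c j s)[i] := List.getElem?_eq_getElem hi
  cases hb : (constraint c j s)[i] with
  | true => simpa using ⟨s, hs.trans (by rw [hb])⟩
  | false =>
    simp only [decide_eq_false_iff_not, not_exists]
    intro t ht
    rw [hb] at hs
    rcases le_total s t with h | h
    · obtain ⟨υ, hυ⟩ := constraint_prefix c j h
      rw [← hυ, List.getElem?_append_left hi, hs] at ht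
      simp at ht
    · obtain ⟨υ, hυ⟩ := constraint_prefix c j h
      rw [← hυ, List.getElem?_append_left (List.getElem?_eq_some_iff.1 ht).1, ht] at hs
      simp at hs

theorem snoc_mem_canonicalTree {C : Set Seq} {σ : List Bool} {b : Bool}
    (h : σ ++ [b] ∈ canonicalTree C) : σ ∈ canonicalTree C := by
  obtain ⟨X, hX, hXC⟩ := h
  exact ⟨X, cylinder_anti (List.prefix_append _ _) hX, hXC⟩

theorem IsSemimeasure.antitone_levelSum {M : List Bool → ℝ} (hM : IsSemimeasure M) (C : Set Seq) :
    Antitone (levelSum M (canonicalTree C)) := by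
  classical
  refine antitone_nat_of_succ_le fun n => ?_
  rw [levelSum_eq, levelSum_eq, sum_strings_succ]
  refine Finset.sum_le_sum fun σ _ => ?_
  by_cases hσ : σ ∈ canonicalTree C
  · rw [if_pos hσ]
    refine le_trans (add_le_add ?_ ?_) (hM.superadditive σ) <;> split_ifs
    exacts [le_rfl, hM.nonneg _, le_rfl, hM.nonneg _]
  · rw [if_neg hσ, if_neg fun h => hσ (snoc_mem_canonicalTree h),
      if_neg fun h => hσ (snoc_mem_canonicalTree h), add_zero]

theorem IsSemimeasure.levelSum_le_one {M : List Bool → ℝ} (hM : IsSemimeasure M)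
    (T : Set (List Bool)) (n : ℕ) : levelSum M T n ≤ 1 := by
  classical
  rw [levelSum_eq]
  refine (Finset.sum_le_sum fun σ _ => ?_).trans (hM.sum_strings_le n)
  split_ifs
  exacts [le_rfl, hM.nonneg σ]

theorem CodeFor.levelSum_constraintClass_le {c : Code} {M : List Bool → ℝ} (hc : CodeFor c M)
    (hM : IsSemimeasure M) (j : ℕ) :
    levelSum M (canonicalTree (constraintClass c)) (2 ^ (j + 2)) ≤ (2 : ℝ)⁻¹ ^ j := by
  classical
  obtain ⟨s, hs⟩ := hc.exists_constraint_light hM j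
  refine le_trans ?_ hs
  rw [levelSum_eq]
  refine Finset.sum_le_sum fun τ hτ => ?_
  by_cases h : τ ∈ canonicalTree (constraintClass c)
  · rw [if_pos h, if_pos]
    obtain ⟨X, hX, hXC⟩ := h
    rw [← mem_cylinder.1 hX, hc.prefix_drop_iff hM X j s (mem_strings.1 hτ).ge]
    exact hXC j s
  · rw [if_neg h]
    split_ifs
    exacts [hM.nonneg τ, le_rfl]

/-- The greatest `k` with `2 ^ (k + 2) ≤ n`, or `0`. -/
def blockOrder (n : ℕ) : ℕ := Nat.findGreatest (fun k => 2 ^ (k + 2) ≤ n) n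

theorem isComputableOrder_blockOrder : IsComputableOrder blockOrder := by
  refine ⟨Primrec.to_comp ?_, fun m n h => ?_, fun k => ⟨2 ^ (k + 2), ?_⟩⟩
  · exact Primrec.nat_findGreatest (f := fun n => n) (p := fun n k => 2 ^ (k + 2) ≤ n) Primrec.id
      (Primrec.nat_le.comp (primrec_two_pow (Primrec.succ.comp (Primrec.succ.comp Primrec.snd)))
        Primrec.fst)
  · exact Nat.findGreatest_mono (fun k (hk : _ ≤ m) => hk.trans h) h
  · have : k + 2 < 2 ^ (k + 2) := Nat.lt_two_pow_self
    exact Nat.le_findGreatest (by omega) le_rfl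

theorem CodeFor.deep_constraintClass {c : Code} {M : List Bool → ℝ} (hc : CodeFor c M)
    (hM : IsSemimeasure M) : Deep M (constraintClass c) := by
  refine ⟨blockOrder, isComputableOrder_blockOrder, fun n => ?_⟩
  -- The value 0 may be the default of the search, with `n < 4`; the trivial bound 1 then suffices.
  by_cases h0 : blockOrder n = 0
  · rw [h0, pow_zero]
    exact hM.levelSum_le_one _ n
  · have h : 2 ^ (blockOrder n + 2) ≤ n := 
      Nat.findGreatest_of_ne_zero (P := fun k => 2 ^ (k + 2) ≤ n) (n := n) rfl h0
    exact (hM.antitone_levelSum _ h).trans (hc.levelSum_constraintClass_le hM _)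

theorem exists_deep {M : List Bool → ℝ} (hM : IsUniversal M) :
    ∃ C : Set Seq, IsPi01 C ∧ C.Nonempty ∧ Deep M C := by
  obtain ⟨c, hc⟩ := hM.2.1.exists_codeFor hM.1.nonneg
  exact ⟨constraintClass c, hc.isPi01_constraintClass hM.1, hc.constraintClass_nonempty hM.1,
    hc.deep_constraintClass hM.1⟩

/-! ### Translates of a deep class are negligible -/

theorem IsSemimeasure.derived_le {M : List Bool → ℝ} (hM : IsSemimeasure M) (σ : List Bool) :
    derived M σ ≤ M σ := by
  refine (ciInf_le ⟨0, ?_⟩ 0).trans (by simp)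
  rintro _ ⟨k, rfl⟩
  exact Finset.sum_nonneg fun v _ => hM.nonneg _

/-- The map `η ↦ M (σ ++ η)` with its root value raised to 1 is again a lower semi-computable
semi-measure, so `M` dominates it. -/
theorem IsUniversal.exists_append_le {M : List Bool → ℝ} (hM : IsUniversal M) (σ : List Bool) :
    ∃ c : ℕ, ∀ η, M (σ ++ η) ≤ c * M η := by
  obtain ⟨code, hcode⟩ := hM.2.1.exists_codeFor hM.1.nonneg
  have hone : M σ ≤ 1 := hM.1.root ▸ hM.1.anti List.nil_prefix
  have hsemi : IsSemimeasure fun η => if η = [] then 1 else M (σ ++ η) := by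
    refine ⟨fun η => ?_, by simp, fun η => ?_⟩
    · split_ifs
      exacts [zero_le_one, hM.1.nonneg _]
    · have e (b : Bool) : η ++ [b] ≠ [] := by simp
      simp only [e, if_false, ← List.append_assoc]
      refine (hM.1.superadditive (σ ++ η)).trans ?_
      split_ifs with h
      · simpa [h] using hone
      · exact le_rfl
  have hlsc : LowerSemicomputable fun η => if η = [] then 1 else M (σ ++ η) := by
    refine ⟨fun η s => if η = [] then (1, 0) else (codeApprox code s (σ ++ η), s), ?_,
      fun η => ?_⟩
    · refine Primrec.to_comp (Primrec.ite (Primrec.eq.comp Primrec.fst (Primrec.const []))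
        (Primrec.const (1, 0)) (Primrec.pair ?_ Primrec.snd))
      exact primrec_codeApprox.comp (Primrec.pair (Primrec.pair (Primrec.const code) Primrec.snd)
        (Primrec.list_append.comp (Primrec.const σ) Primrec.fst))
    · by_cases hη : η = []
      · simp [hη, monotone_const]
      · simp only [hη, if_false]
        exact ⟨monotone_div_of_double fun s => two_mul_codeApprox_le code s _, (hcode _).2⟩
  obtain ⟨c, hc⟩ := hM.2.2 _ hsemi hlsc
  refine ⟨c, fun η => le_trans ?_ (hc η)⟩
  split_ifs with h
  · simpa [h] using hone
  · exact le_rfl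

theorem Deep.exists_levelSum_lt {M : List Bool → ℝ} {C : Set Seq} (hC : Deep M C) {ε : ℝ}
    (hε : 0 < ε) : ∃ n, levelSum M (canonicalTree C) n < ε := by
  obtain ⟨h, ⟨-, -, hunb⟩, hdeep⟩ := hC
  obtain ⟨k, hk⟩ := exists_pow_lt_of_lt_one hε (show (2 : ℝ)⁻¹ < 1 by norm_num)
  obtain ⟨n, hn⟩ := hunb k
  exact ⟨n, (hdeep n).trans_lt ((pow_le_pow_of_le_one (by norm_num) (by norm_num) hn).trans_lt hk)⟩

open Classical in
theorem IsUniversal.exists_sum_append_lt {M : List Bool → ℝ} (hM : IsUniversal M) {C : Set Seq}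
    (hC : Deep M C) (σ : List Bool) {ε : ℝ} (hε : 0 < ε) :
    ∃ n, ∑ η ∈ strings n with η ∈ canonicalTree C, M (σ ++ η) < ε := by
  obtain ⟨c, hc⟩ := hM.exists_append_le σ
  obtain ⟨n, hn⟩ := hC.exists_levelSum_lt (show 0 < ε / (c + 1) by positivity)
  refine ⟨n, ?_⟩
  rw [levelSum_eq, ← Finset.sum_filter, lt_div_iff₀ (by positivity)] at hn
  refine lt_of_le_of_lt ?_ hn
  rw [Finset.sum_mul]
  refine Finset.sum_le_sum fun η _ => (hc η).trans ?_
  nlinarith [hM.1.nonneg η]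

/-- For each `σ`, the translate `σ⌢C` is covered by the cylinders of `σ ++ η` with `η` in one level
of the tree of `C`. Depth makes the weight of this cover less than a prescribed `δ σ`, with the `δ
σ` summing to less than `ε`. -/
theorem IsUniversal.negligible_of_tails {M : List Bool → ℝ} (hM : IsUniversal M) {C D : Set Seq}
    (hC : Deep M C) (hD : ∀ Y ∈ D, ∃ σ : List Bool, ∃ X ∈ C, Y = concat σ X) :
    Negligible M D := by
  classical
  refine le_antisymm (ENNReal.le_of_forall_pos_le_add fun ε hε _ => ?_) zero_le
  rw [zero_add]
  obtain ⟨δ, hδ, hsum⟩ := ENNReal.exists_pos_sum_of_countable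
    (ENNReal.coe_ne_zero.2 hε.ne') (List Bool)
  choose n hn using fun σ => hM.exists_sum_append_lt hC σ (NNReal.coe_pos.2 (hδ σ))
  let F (σ : List Bool) : Finset (List Bool) :=
    ({η ∈ strings (n σ) | η ∈ canonicalTree C}).image (σ ++ ·)
  have hcover : D ⊆ ⋃ σ ∈ ⋃ σ, (F σ : Set (List Bool)), cylinder σ := by
    intro Y hY
    obtain ⟨σ, X, hX, rfl⟩ := hD Y hY
    refine Set.mem_biUnion (x := σ ++ restrict X (n σ)) (Set.mem_iUnion.2 ⟨σ, ?_⟩) ?_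
    · refine Finset.mem_coe.2 (Finset.mem_image_of_mem _ (Finset.mem_filter.2 ⟨by simp, ?_⟩))
      exact ⟨X, mem_cylinder_restrict X _, hX⟩
    · rw [← restrict_concat]
      exact mem_cylinder_restrict _ _
  refine (iInf₂_le (⋃ σ, (F σ : Set (List Bool))) hcover).trans
    ((ENNReal.tsum_iUnion_le_tsum (fun τ => ENNReal.ofReal (derived M τ)) _).trans
    ((ENNReal.tsum_le_tsum fun σ => ?_).trans hsum.le))
  refine (Finset.tsum_subtype (F σ) fun τ => ENNReal.ofReal (derived M τ)).trans_le ?_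
  rw [Finset.sum_image fun a _ b _ h => List.append_cancel_left h]
  calc ∑ η ∈ strings (n σ) with η ∈ canonicalTree C, ENNReal.ofReal (derived M (σ ++ η))
      ≤ ∑ η ∈ strings (n σ) with η ∈ canonicalTree C, ENNReal.ofReal (M (σ ++ η)) :=
        Finset.sum_le_sum fun η _ => ENNReal.ofReal_le_ofReal (hM.1.derived_le _)
    _ = ENNReal.ofReal (∑ η ∈ strings (n σ) with η ∈ canonicalTree C, M (σ ++ η)) :=
        (ENNReal.ofReal_sum_of_nonneg fun η _ => hM.1.nonneg _).symm
    _ ≤ ENNReal.ofReal (δ σ) := ENNReal.ofReal_le_ofReal (hn σ).le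
    _ = δ σ := ENNReal.ofReal_coe_nnreal

end Cantor

end

/-! ### The main theorem -/

theorem mainTheorem3 :
    (∃ M : List Bool → ℝ, Cantor.IsUniversal M) ∧
    ∀ M : List Bool → ℝ, Cantor.IsUniversal M →
      (∀ C : Set Cantor.Seq, Cantor.IsPi01 C → C.Nonempty →
        ∃ D : Set Cantor.Seq, Cantor.IsPi01 D ∧
          C ⊆ D ∧ (∀ Y ∈ D, ∃ σ : List Bool, ∃ X ∈ C, Y = Cantor.concat σ X) ∧
          Cantor.SameTuringDegrees C D ∧
          ¬ Cantor.Deep M D) ∧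
      (∃ C D : Set Cantor.Seq, Cantor.IsPi01 C ∧ Cantor.IsPi01 D ∧
        Cantor.SameTuringDegrees C D ∧ Cantor.MuchnikEquivalent C D ∧
        Cantor.Deep M C ∧ ¬ Cantor.Deep M D) ∧
      (∃ D : Set Cantor.Seq, Cantor.IsPi01 D ∧ Cantor.Negligible M D ∧ ¬ Cantor.Deep M D) := by
  refine ⟨Cantor.exists_universal, fun M hM => ⟨fun C hC hne => ?_, ?_⟩⟩
  · obtain ⟨D, hD, hCD, htail, hdeep⟩ := Cantor.exists_nonDeep_extension hM hC hne
    exact ⟨D, hD, hCD, htail, Cantor.sameTuringDegrees_of_tails hCD htail, hdeep⟩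
  · obtain ⟨C, hC, hne, hCdeep⟩ := Cantor.exists_deep hM
    -- The same `D`, built from a deep `C`, witnesses both (2) and (3).
    obtain ⟨D, hD, hCD, htail, hdeep⟩ := Cantor.exists_nonDeep_extension hM hC hne
    have hsame := Cantor.sameTuringDegrees_of_tails hCD htail
    exact ⟨⟨C, D, hC, hD, hsame, hsame.muchnikEquivalent, hCdeep, hdeep⟩,
      D, hD, hM.negligible_of_tails hCdeep htail, hdeep⟩
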